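/- We work over $\mathbb{C}$. Let $\varphi=[F_0,\ldots,F_4]\colon \mathbb{P}^3 \dashrightarrow \mathbb{P}^4$ be a rational map defined by quadratic forms $F_0,\ldots,F_4$ without non-constant common factor, and suppose that the closure of the image of $\varphi$ is an irreducible quadric hypersurface $Q=V(q)\subset\mathbb{P}^4$ ($q$ an irreducible quadratic form) and that $\varphi$ is birational onto $Q$. Suppose moreover that the base locus $B=V(F_0,\ldots,F_4)\subset\mathbb{P}^3$ is nonempty and reduced as a scheme. For $d\geq 1$ say that $\varphi$ is of type $(2,d)$ if $d$ is the least integer such that $\varphi^{-1}\colon Q\dashrightarrow\mathbb{P}^3$ can be given by four forms of degree $d$ in the coordinates of $\mathbb{P}^4$, not all vanishing identically on $Q$. Then one of the following holds: (i) $\varphi$ is of type $(2,1)$; or (ii) $\varphi$ is of type $(2,2)$, the quadratic form $q$ has rank $4$, and $B$ is the union of a line $r$ and two distinct points $p_1,p_2$ such that the line joining $p_1$ and $p_2$ is disjoint from $r$. -/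

import Mathlib

namespace QuadBir

/-- The set of closed points of the complex projective space `ℙ^{k-1}` with homogeneous coordinates
indexed by `Fin k`. -/
abbrev PSpace (k : ℕ) : Type := Projectivization ℂ (Fin k → ℂ)

/-- The form `g` vanishes at the point `p`. (Only used for homogeneous `g`, where it does not
depend on the choice of the homogeneous coordinates, see `vanishesAt_mk`.) -/
def VanishesAt {k : ℕ} (g : MvPolynomial (Fin k) ℂ) (p : PSpace k) : Prop :=
  MvPolynomial.eval p.rep g = 0

/-- A homogeneous polynomial of degree `d` satisfies `g (c x) = c ^ d g (x)`. -/
theorem eval_smul_of_isHomogeneous {k d : ℕ} {g : MvPolynomial (Fin k) ℂ} (hg : g.IsHomogeneous d)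
    (c : ℂ) (x : Fin k → ℂ) :
    MvPolynomial.eval (c • x) g = c ^ d * MvPolynomial.eval x g := by
  rw [MvPolynomial.eval_eq, MvPolynomial.eval_eq, Finset.mul_sum]
  refine Finset.sum_congr rfl fun m hm => ?_
  have h : ∑ i ∈ m.support, m i = d := by
    have h' := hg (MvPolynomial.mem_support_iff.mp hm)
    simpa [Finsupp.weight_apply, Finsupp.sum] using h'
  simp only [Pi.smul_apply, smul_eq_mul, mul_pow, Finset.prod_mul_distrib,
    Finset.prod_pow_eq_pow_sum, h]
  ring

/-- Vanishing of a form can be tested on any choice of homogeneous coordinates. -/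
theorem vanishesAt_mk {k d : ℕ} {g : MvPolynomial (Fin k) ℂ} (hg : g.IsHomogeneous d)
    (x : Fin k → ℂ) (hx : x ≠ 0) :
    VanishesAt g (Projectivization.mk ℂ x hx) ↔ MvPolynomial.eval x g = 0 := by
  obtain ⟨a, ha⟩ := Projectivization.exists_smul_eq_mk_rep ℂ x hx
  have ha' : (Projectivization.mk ℂ x hx).rep = (a : ℂ) • x := by rw [← ha]; rfl
  rw [VanishesAt, ha', eval_smul_of_isHomogeneous hg]
  simp

/-- The common zero set in projective space of a family of forms. -/
def zeroSet {k : ℕ} {ι : Type} (F : ι → MvPolynomial (Fin k) ℂ) : Set (PSpace k) :=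
  {p | ∀ i, VanishesAt (F i) p}

/-- The projective hypersurface `V(q)`, as a set of points. -/
def hypersurface {k : ℕ} (q : MvPolynomial (Fin k) ℂ) : Set (PSpace k) :=
  {p | VanishesAt q p}

/-- The Zariski closure of a set of points of projective space: the points at which every form
vanishing on the set vanishes. -/
def zariskiClosure {k : ℕ} (S : Set (PSpace k)) : Set (PSpace k) :=
  {y | ∀ (d : ℕ) (g : MvPolynomial (Fin k) ℂ), g.IsHomogeneous d →
    (∀ z ∈ S, VanishesAt g z) → VanishesAt g y}

/-- The map of affine spaces `x ↦ (F₁(x), …, F_m(x))`. -/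
noncomputable def evalForms {k m : ℕ} (F : Fin m → MvPolynomial (Fin k) ℂ) (x : Fin k → ℂ) :
    Fin m → ℂ :=
  fun i => MvPolynomial.eval x (F i)

/-- For forms `F₁, …, F_m` of the same degree, `SendsTo F p y` says that these forms do not all
vanish at `p` and that `y = [F₁(p), …, F_m(p)]`: it is the graph of the map
`[F₁, …, F_m]` on the complement of the common zeros of the `Fᵢ`. -/
def SendsTo {k m : ℕ} (F : Fin m → MvPolynomial (Fin k) ℂ) (p : PSpace k) (y : PSpace m) : Prop :=
  ∃ (x : Fin k → ℂ) (hx : x ≠ 0) (hF : evalForms F x ≠ 0),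
    p = Projectivization.mk ℂ x hx ∧ y = Projectivization.mk ℂ (evalForms F x) hF

/-- The set of all points `[F₁(p), …, F_m(p)]`. -/
def imageSet {k m : ℕ} (F : Fin m → MvPolynomial (Fin k) ℂ) : Set (PSpace m) :=
  {y | ∃ p, SendsTo F p y}

/-- Let `φ = [F] : ℙⁿ ⇢ V(q) ⊂ ℙⁿ⁺¹`. The forms `G₀, …, Gₙ` have degree `d`, do not all vanish
identically on the hypersurface `V(q)`, and the rational map `ψ = [G] : V(q) ⇢ ℙⁿ` they define
(by a linear system contained in `|𝒪_{V(q)}(d)|`) is inverse to `φ`: `ψ ∘ φ` and `φ ∘ ψ` are the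
identity wherever they are defined by these forms. -/
structure IsInverseOfDegree {n : ℕ} (F : Fin (n + 2) → MvPolynomial (Fin (n + 1)) ℂ)
    (q : MvPolynomial (Fin (n + 2)) ℂ) (d : ℕ)
    (G : Fin (n + 1) → MvPolynomial (Fin (n + 2)) ℂ) : Prop where
  homogeneous : ∀ i, (G i).IsHomogeneous d
  defined : ∃ y ∈ hypersurface q, ∃ p, SendsTo G y p
  left_inv : ∀ p y p', SendsTo F p y → SendsTo G y p' → p' = p
  right_inv : ∀ y ∈ hypersurface q, ∀ p y', SendsTo G y p → SendsTo F p y' → y' = y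

/-- `F₀, …, Fₙ₊₁` define a quadratic birational map `φ` of `ℙⁿ` onto the irreducible quadric
hypersurface `V(q) ⊂ ℙⁿ⁺¹`, where `V(q)` is the closure of the image of `φ`. -/
structure IsQuadraticBirationalOntoQuadric {n : ℕ}
    (F : Fin (n + 2) → MvPolynomial (Fin (n + 1)) ℂ) (q : MvPolynomial (Fin (n + 2)) ℂ) : Prop where
  /-- `φ` is given by quadratic forms -/
  quadratic : ∀ i, (F i).IsHomogeneous 2
  /-- the linear system of quadrics has no fixed component -/
  no_fixed_component : ∀ g : MvPolynomial (Fin (n + 1)) ℂ, (∀ i, g ∣ F i) → IsUnit g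
  quadric : q.IsHomogeneous 2
  irreducible_quadric : Irreducible q
  closure_image : zariskiClosure (imageSet F) = hypersurface q
  birational : ∃ d G, IsInverseOfDegree F q d G

/-- `φ = [F]` is of type `(2, d)`: it is quadratic, and `d` is the least degree such that the
inverse of `φ` can be defined by a linear system contained in `|𝒪_{V(q)}(d)|`. -/
def IsOfTypeTwo {n : ℕ} (F : Fin (n + 2) → MvPolynomial (Fin (n + 1)) ℂ)
    (q : MvPolynomial (Fin (n + 2)) ℂ) (d : ℕ) : Prop :=
  IsQuadraticBirationalOntoQuadric F q ∧ IsLeast {e : ℕ | ∃ G, IsInverseOfDegree F q e G} d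

/-- Substitution of `1` for the variable `xᵢ`. -/
noncomputable def dehomogenize {k : ℕ} (i : Fin k) :
    MvPolynomial (Fin k) ℂ →ₐ[ℂ] MvPolynomial {j : Fin k // j ≠ i} ℂ :=
  MvPolynomial.aeval fun j => if h : j = i then 1 else MvPolynomial.X ⟨j, h⟩

/-- The ideal of the scheme of common zeros of the forms `F` in the standard affine chart
`xᵢ ≠ 0`. -/
noncomputable def chartIdeal {k m : ℕ} (F : Fin m → MvPolynomial (Fin k) ℂ) (i : Fin k) :
    Ideal (MvPolynomial {j : Fin k // j ≠ i} ℂ) :=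
  Ideal.span (Set.range fun a => dehomogenize i (F a))

/-- The closed subscheme of projective space defined by the forms `F` is reduced, i.e. its
coordinate ring in each of the standard affine charts is reduced. -/
def ZeroSchemeIsReduced {k m : ℕ} (F : Fin m → MvPolynomial (Fin k) ℂ) : Prop :=
  ∀ i, IsReduced (MvPolynomial {j : Fin k // j ≠ i} ℂ ⧸ chartIdeal F i)

/-- The rank of a quadratic form `q`: the rank of the symmetric matrix of its (constant) second
partial derivatives, which is twice the Gram matrix of `q`. -/
noncomputable def quadricRank {k : ℕ} (q : MvPolynomial (Fin k) ℂ) : ℕ :=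
  (Matrix.of fun i j : Fin k =>
    MvPolynomial.coeff 0 (MvPolynomial.pderiv i (MvPolynomial.pderiv j q))).rank

end QuadBir

namespace QuadBir

open MvPolynomial

/-! Everything is read off the five-dimensional space `V` spanned by the `F i`. Over ℂ, `q` is a sum
of `k` squares of independent linear forms, and irreducibility forces `k ≥ 3`. The `F i` are
linearly independent, so substituting them gives `k` independent quadrics in `V` whose squares sum
to zero. Unique factorization turns this identity into explicit members of `V`. Reducedness of `B`
enters as a statement on tangent vectors: a linear form with a power in the ideal of `B` kills every
tangent vector of `B`.

Rank 3 (`not_rank_three`): `f₀ f₂ = f₁²` forces `a²`, `ad`, `d²` into `V` for independent linear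
forms `a`, `d`. The base scheme is then supported on the line `a = d = 0`, and the two remaining
quadrics are too few to make it reduced.

Rank 4 (`isConicType_or_isLineType_of_rank_four`): `f₀ f₃ = f₁ f₂` factors as `(ab)(dc) = (ac)(db)`,
so `V` contains all products of the pencils spanned by `a, d` and by `b, c`, and only one quadric is
unknown. If the lines `a = d = 0` and `b = c = 0` are skew, generic injectivity and reducedness
leave the quadrics through one line and two points. If the lines meet, they leave a system
containing `m · X i` for a fixed linear form `m`.

Rank 5 (`isConicType_of_rank_five`): at a base point `p` one has `F(x + tp) = F(x) + t L(x)` with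
`L` linear, and `q(F) = 0` gives `∑ Fᵢ Lᵢ = 0` and `∑ Lᵢ² = 0`. The image of `L` is isotropic, so of
dimension at most 2. Dimensions 0 and 1 are impossible, and dimension 2 gives a linear syzygy
between two members of `V`, from which again all `m · X i` lie in `V` (`isConicType_of_syzygy`).

If all `m · X i` lie in `V`, suitable linear forms on ℙ⁴ pull back to them, so the inverse is
linear. For the line and two points an inverse of degree 2 is explicit. One of degree 1 would
compose with `φ` to a linear form times the identity; that form would vanish on `B`, which spans ℙ³.
-/

/-! ### Linear forms and linear changes of coordinates. -/

/-- The linear form with coefficient vector `v`. -/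
noncomputable def linForm {k : ℕ} : (Fin k → ℂ) →ₗ[ℂ] MvPolynomial (Fin k) ℂ :=
  Fintype.linearCombination ℂ (X : Fin k → MvPolynomial (Fin k) ℂ)

theorem linForm_apply {k : ℕ} (v : Fin k → ℂ) : linForm v = ∑ i, v i • X i := rfl

theorem aeval_linForm {k : ℕ} {A : Type*} [CommRing A] [Algebra ℂ A] (v : Fin k → ℂ)
    (x : Fin k → A) : aeval x (linForm v) = ∑ i, v i • x i := by
  simp [linForm_apply]

theorem eval_linForm {k : ℕ} (v x : Fin k → ℂ) : eval x (linForm v) = v ⬝ᵥ x := by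
  simp [linForm_apply, dotProduct, smul_eval]

theorem linForm_injective {k : ℕ} : Function.Injective (linForm (k := k)) := by
  rw [injective_iff_map_eq_zero]
  intro v hv
  ext i
  have h := congrArg (eval (Pi.single i 1)) hv
  simpa [eval_linForm] using h

theorem linForm_eq_zero {k : ℕ} {v : Fin k → ℂ} : linForm v = 0 ↔ v = 0 :=
  map_eq_zero_iff _ linForm_injective

theorem linForm_isHomogeneous {k : ℕ} (v : Fin k → ℂ) : (linForm v).IsHomogeneous 1 := by
  rw [linForm_apply]
  refine IsHomogeneous.sum _ _ _ fun i _ => ?_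
  rw [smul_eq_C_mul]
  exact isHomogeneous_C_mul_X _ _

theorem exists_eq_linForm {k : ℕ} {f : MvPolynomial (Fin k) ℂ} (hf : f.IsHomogeneous 1) :
    ∃ v, f = linForm v := by
  have h : f ∈ homogeneousSubmodule (Fin k) ℂ 1 := hf
  rw [homogeneousSubmodule_one_eq_span_X, Submodule.mem_span_range_iff_exists_fun] at h
  obtain ⟨c, hc⟩ := h
  exact ⟨c, hc.symm⟩

theorem linForm_single {k : ℕ} (i : Fin k) : linForm (Pi.single i 1) = X i := by
  simp [linForm_apply, Pi.single_apply]

theorem prime_linForm {k : ℕ} {v : Fin k → ℂ} (hv : v ≠ 0) : Prime (linForm v) := by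
  have h0 : linForm v ≠ 0 := fun h => hv (linForm_eq_zero.mp h)
  refine (MvPolynomial.irreducible_of_totalDegree_eq_one
    ((linForm_isHomogeneous v).totalDegree h0) fun x hx => ?_).prime
  obtain ⟨d, hd⟩ := ne_zero_iff.mp h0
  exact (isUnit_iff_ne_zero.mpr fun h => hd (by have := hx d; rw [h] at this; exact zero_dvd_iff.mp this))

/-- The substitution `X ↦ T X`. -/
noncomputable def subst {k : ℕ} (T : Matrix (Fin k) (Fin k) ℂ) :
    MvPolynomial (Fin k) ℂ →ₐ[ℂ] MvPolynomial (Fin k) ℂ :=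
  aeval fun i => linForm (T i)

theorem aeval_subst {k : ℕ} {A : Type*} [CommRing A] [Algebra ℂ A]
    (T : Matrix (Fin k) (Fin k) ℂ) (x : Fin k → A) (f : MvPolynomial (Fin k) ℂ) :
    aeval x (subst T f) = aeval (fun i => ∑ j, T i j • x j) f := by
  have : (aeval x).comp (subst T) = aeval (R := ℂ) (fun i => ∑ j, T i j • x j) := by
    ext i
    simp [subst, aeval_linForm]
  exact DFunLike.congr_fun this f

theorem eval_subst {k : ℕ} (T : Matrix (Fin k) (Fin k) ℂ) (x : Fin k → ℂ)
    (f : MvPolynomial (Fin k) ℂ) : eval x (subst T f) = eval (T.mulVec x) f := by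
  have := aeval_subst T x f
  simp only [aeval_eq_eval, smul_eq_mul] at this
  exact this

theorem subst_subst {k : ℕ} (S T : Matrix (Fin k) (Fin k) ℂ) (f : MvPolynomial (Fin k) ℂ) :
    subst S (subst T f) = subst (T * S) f := by
  apply MvPolynomial.funext
  intro x
  simp [eval_subst]

theorem subst_one {k : ℕ} (f : MvPolynomial (Fin k) ℂ) : subst 1 f = f := by
  apply MvPolynomial.funext
  intro x
  simp [eval_subst]

theorem subst_X {k : ℕ} (T : Matrix (Fin k) (Fin k) ℂ) (i : Fin k) :
    subst T (X i) = linForm (T i) := by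
  simp [subst]

theorem subst_isHomogeneous {k d : ℕ} (T : Matrix (Fin k) (Fin k) ℂ)
    {f : MvPolynomial (Fin k) ℂ} (hf : f.IsHomogeneous d) : (subst T f).IsHomogeneous d := by
  have := hf.aeval (fun i => linForm (T i)) (n := 1) (fun i => linForm_isHomogeneous _)
  simpa [subst] using this

theorem subst_inv_subst {k : ℕ} {T : Matrix (Fin k) (Fin k) ℂ} (hT : IsUnit T)
    (f : MvPolynomial (Fin k) ℂ) : subst T⁻¹ (subst T f) = f := by
  rw [subst_subst, Matrix.mul_nonsing_inv _ ((Matrix.isUnit_iff_isUnit_det T).mp hT), subst_one]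

theorem subst_subst_inv {k : ℕ} {T : Matrix (Fin k) (Fin k) ℂ} (hT : IsUnit T)
    (f : MvPolynomial (Fin k) ℂ) : subst T (subst T⁻¹ f) = f := by
  rw [subst_subst, Matrix.nonsing_inv_mul _ ((Matrix.isUnit_iff_isUnit_det T).mp hT), subst_one]

theorem subst_injective {k : ℕ} {T : Matrix (Fin k) (Fin k) ℂ} (hT : IsUnit T) :
    Function.Injective (subst T) :=
  Function.LeftInverse.injective (subst_inv_subst hT)

/-! ### Homogeneity of factors, bases and quadratic forms. -/

/-- The map `f(X) ↦ f(t X)`. -/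
noncomputable def scaleHom (σ : Type*) :
    MvPolynomial σ ℂ →ₐ[ℂ] Polynomial (MvPolynomial σ ℂ) :=
  aeval fun i => Polynomial.C (X i) * Polynomial.X

theorem coeff_scaleHom {σ : Type*} (f : MvPolynomial σ ℂ) (n : ℕ) :
    (scaleHom σ f).coeff n = homogeneousComponent n f := by
  classical
  induction f using MvPolynomial.induction_on' with
  | monomial d a =>
    have : scaleHom σ (monomial d a) = Polynomial.monomial d.degree (monomial d a) := by
      rw [scaleHom, aeval_monomial, Finsupp.prod]
      simp only [mul_pow, Finset.prod_mul_distrib, Finset.prod_pow_eq_pow_sum]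
      rw [← Polynomial.C_mul_X_pow_eq_monomial, ← mul_assoc, monomial_eq, Polynomial.C_mul]
      simp only [Finsupp.prod, map_prod, map_pow]
      rfl
    rw [this, Polynomial.coeff_monomial]
    have hm : (monomial d a).IsHomogeneous d.degree := isHomogeneous_monomial a rfl
    rw [homogeneousComponent_of_mem (n := d.degree) hm]
    simp [eq_comm]
  | add p q hp hq => simp [hp, hq]

theorem scaleHom_of_isHomogeneous {σ : Type*} {f : MvPolynomial σ ℂ} {n : ℕ}
    (hf : f.IsHomogeneous n) : scaleHom σ f = Polynomial.monomial n f := by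
  ext1 m
  rw [coeff_scaleHom, Polynomial.coeff_monomial, homogeneousComponent_of_mem (n := n) hf]
  simp [eq_comm]

theorem scaleHom_ne_zero {σ : Type*} {f : MvPolynomial σ ℂ} (hf : f ≠ 0) : scaleHom σ f ≠ 0 := by
  intro h
  apply hf
  rw [← sum_homogeneousComponent f]
  exact Finset.sum_eq_zero fun i _ => by rw [← coeff_scaleHom, h, Polynomial.coeff_zero]

/-- Over a domain the highest and the lowest degree in `t` of `f(tX)` are both additive in products.
They agree for the product, hence for each factor. -/
theorem isHomogeneous_of_mul {σ : Type*} {f g : MvPolynomial σ ℂ} {n : ℕ}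
    (h : (f * g).IsHomogeneous n) (h0 : f * g ≠ 0) :
    ∃ i j, i + j = n ∧ f.IsHomogeneous i ∧ g.IsHomogeneous j := by
  have hf := scaleHom_ne_zero (left_ne_zero_of_mul h0)
  have hg := scaleHom_ne_zero (right_ne_zero_of_mul h0)
  have hm := scaleHom_of_isHomogeneous h
  rw [map_mul] at hm
  have h1 := Polynomial.natDegree_mul hf hg
  have h2 := Polynomial.natTrailingDegree_mul hf hg
  rw [hm, Polynomial.natDegree_monomial_eq _ h0] at h1
  rw [hm, Polynomial.natTrailingDegree_monomial h0] at h2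
  have h3 := Polynomial.natTrailingDegree_le_natDegree (scaleHom σ f)
  have h4 := Polynomial.natTrailingDegree_le_natDegree (scaleHom σ g)
  have key : ∀ u : MvPolynomial σ ℂ,
      (scaleHom σ u).natTrailingDegree = (scaleHom σ u).natDegree →
      u.IsHomogeneous (scaleHom σ u).natDegree := by
    intro u hu
    have : u = homogeneousComponent (scaleHom σ u).natDegree u := by
      conv_lhs => rw [← sum_homogeneousComponent u]
      by_cases hd : (scaleHom σ u).natDegree ∈ Finset.range (u.totalDegree + 1)
      · refine Finset.sum_eq_single_of_mem _ hd fun i _ hi => ?_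
        rw [← coeff_scaleHom]
        rcases lt_or_gt_of_ne hi with hi | hi
        · exact Polynomial.coeff_eq_zero_of_lt_natTrailingDegree (hu ▸ hi)
        · exact Polynomial.coeff_eq_zero_of_natDegree_lt hi
      · rw [homogeneousComponent_eq_zero _ _ (by simpa using hd)]
        refine Finset.sum_eq_zero fun i hi' => ?_
        have hi : i ≠ (scaleHom σ u).natDegree := fun h => hd (h ▸ hi')
        rw [← coeff_scaleHom]
        rcases lt_or_gt_of_ne hi with hi | hi
        · exact Polynomial.coeff_eq_zero_of_lt_natTrailingDegree (hu ▸ hi)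
        · exact Polynomial.coeff_eq_zero_of_natDegree_lt hi
    have hc := homogeneousComponent_isHomogeneous (scaleHom σ u).natDegree u
    rwa [← this] at hc
  refine ⟨_, _, h1.symm, key f (by omega), key g (by omega)⟩

theorem isHomogeneous_of_mul_left {σ : Type*} {f g : MvPolynomial σ ℂ} {m n : ℕ}
    (h : (f * g).IsHomogeneous (m + n)) (h0 : f * g ≠ 0) (hf : f.IsHomogeneous m) :
    g.IsHomogeneous n := by
  obtain ⟨i, j, hij, hi, hj⟩ := isHomogeneous_of_mul h h0
  have := hi.inj_right hf (left_ne_zero_of_mul h0)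
  obtain rfl : j = n := by omega
  exact hj

theorem exists_eval_ne_zero {k : ℕ} {f : MvPolynomial (Fin k) ℂ} (hf : f ≠ 0) :
    ∃ x, eval x f ≠ 0 := by
  by_contra! h
  exact hf (MvPolynomial.funext fun x => by simp [h x])

theorem eq_C_of_isHomogeneous_zero {σ : Type*} {f : MvPolynomial σ ℂ} (hf : f.IsHomogeneous 0) :
    ∃ c, f = C c :=
  ⟨_, totalDegree_eq_zero_iff_eq_C.mp ((totalDegree_zero_iff_isHomogeneous σ).mpr hf)⟩

/-- Linear forms in general position complete to a coordinate system. -/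
theorem exists_matrix_of_linearIndependent {j k : ℕ} {v : Fin j → Fin k → ℂ}
    (hv : LinearIndependent ℂ v) : ∃ (T : Matrix (Fin k) (Fin k) ℂ) (h : j ≤ k),
      IsUnit T ∧ ∀ i, T (Fin.castLE h i) = v i := by
  have hj : j ≤ k := by simpa using hv.fintype_card_le_finrank
  obtain ⟨d, hd⟩ : ∃ d, k = j + d := ⟨k - j, by omega⟩
  induction d generalizing j with
  | zero =>
    obtain rfl : k = j := by omega
    exact ⟨v, le_rfl, Matrix.linearIndependent_rows_iff_isUnit.mp hv, fun i => rfl⟩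
  | succ d ih =>
    obtain ⟨x, hx⟩ := exists_linearIndependent_snoc_of_lt_finrank (R := ℂ) hv
      (by simp; omega)
    obtain ⟨T, h, hT, hTv⟩ := ih hx (by omega) (by omega)
    refine ⟨T, hj, hT, fun i => ?_⟩
    have := hTv i.castSucc
    simpa using this

theorem exists_eq_sum_of_isHomogeneous_two {k : ℕ} {f : MvPolynomial (Fin k) ℂ}
    (hf : f.IsHomogeneous 2) :
    ∃ c : Fin k → Fin k → ℂ, f = ∑ i, ∑ j, c i j • (X i * X j) := by
  have h : f ∈ homogeneousSubmodule (Fin k) ℂ 2 := hf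
  clear hf
  rw [← homogeneousSubmodule_one_pow, pow_two, homogeneousSubmodule_one_eq_span_X,
    Submodule.span_mul_span] at h
  induction h using Submodule.span_induction with
  | mem x hx =>
    obtain ⟨_, ⟨i, rfl⟩, _, ⟨j, rfl⟩, rfl⟩ := hx
    refine ⟨fun a b => if a = i ∧ b = j then 1 else 0, ?_⟩
    simp [ite_and]
  | zero => exact ⟨0, by simp⟩
  | add x y _ _ hx hy =>
    obtain ⟨c, rfl⟩ := hx
    obtain ⟨d, rfl⟩ := hy
    exact ⟨c + d, by simp [add_smul, Finset.sum_add_distrib]⟩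
  | smul a x _ hx =>
    obtain ⟨c, rfl⟩ := hx
    exact ⟨a • c, by simp [mul_smul, Finset.smul_sum]⟩

/-! ### Linear systems of quadrics and their invariance under coordinate changes. -/

/-- A linear system of quadrics in `ℙ³` with the properties of the system that defines a birational
map onto a quadric threefold with reduced nonempty base locus. -/
structure GoodSystem (V : Submodule ℂ (MvPolynomial (Fin 4) ℂ)) : Prop where
  hom : ∀ f ∈ V, f.IsHomogeneous 2
  finrank_eq : Module.finrank ℂ V = 5
  inj : ∃ D : MvPolynomial (Fin 4) ℂ, D ≠ 0 ∧ ∀ (x x' : Fin 4 → ℂ) (c : ℂ), eval x D ≠ 0 →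
    c ≠ 0 → (∀ f ∈ V, eval x' f = c * eval x f) → ∃ t : ℂ, x' = t • x
  red : ∀ (f : MvPolynomial (Fin 4) ℂ) (d n : ℕ), f.IsHomogeneous d →
    f ^ n ∈ Ideal.span (V : Set (MvPolynomial (Fin 4) ℂ)) → ∀ x : Fin 4 → DualNumber ℂ,
    (∃ i, (x i).fst ≠ 0) → (∀ g ∈ V, aeval x g = 0) → aeval x f = 0
  base : ∃ p : Fin 4 → ℂ, p ≠ 0 ∧ ∀ f ∈ V, eval p f = 0

/-- The quadrics of the system contain the products of all linear forms with a fixed one. -/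
def IsConicType (V : Submodule ℂ (MvPolynomial (Fin 4) ℂ)) : Prop :=
  ∃ m : MvPolynomial (Fin 4) ℂ, m ≠ 0 ∧ ∀ i, m * X i ∈ V

/-- In suitable coordinates the system is that of the quadrics through the line `X₀ = X₁ = 0` and
the points `[1, 0, 0, 0]` and `[0, 1, 0, 0]`. -/
def IsLineType (V : Submodule ℂ (MvPolynomial (Fin 4) ℂ)) : Prop :=
  ∃ T : Matrix (Fin 4) (Fin 4) ℂ, IsUnit T ∧ subst T (X 0 * X 2) ∈ V ∧ subst T (X 0 * X 3) ∈ V ∧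
    subst T (X 1 * X 2) ∈ V ∧ subst T (X 1 * X 3) ∈ V ∧ subst T (X 0 * X 1) ∈ V

/-- The linear system `V` in the coordinates `S`. -/
noncomputable def substSystem (S : Matrix (Fin 4) (Fin 4) ℂ)
    (V : Submodule ℂ (MvPolynomial (Fin 4) ℂ)) : Submodule ℂ (MvPolynomial (Fin 4) ℂ) :=
  V.map (subst S).toLinearMap

theorem mem_substSystem {S : Matrix (Fin 4) (Fin 4) ℂ}
    {V : Submodule ℂ (MvPolynomial (Fin 4) ℂ)} {f : MvPolynomial (Fin 4) ℂ} (hf : f ∈ V) :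
    subst S f ∈ substSystem S V :=
  Submodule.mem_map_of_mem (f := (subst S).toLinearMap) hf

theorem subst_inv_mem {S : Matrix (Fin 4) (Fin 4) ℂ} (hS : IsUnit S)
    {V : Submodule ℂ (MvPolynomial (Fin 4) ℂ)} {f : MvPolynomial (Fin 4) ℂ}
    (hf : f ∈ substSystem S V) : subst S⁻¹ f ∈ V := by
  obtain ⟨g, hg, rfl⟩ := hf
  simpa [subst_inv_subst hS] using hg

theorem mem_substSystem_inv {T : Matrix (Fin 4) (Fin 4) ℂ} (hT : IsUnit T)
    {V : Submodule ℂ (MvPolynomial (Fin 4) ℂ)} {f : MvPolynomial (Fin 4) ℂ}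
    (hf : subst T f ∈ V) : f ∈ substSystem T⁻¹ V := by
  have := mem_substSystem (S := T⁻¹) hf
  rwa [subst_inv_subst hT] at this

theorem GoodSystem.subst {V : Submodule ℂ (MvPolynomial (Fin 4) ℂ)} (hV : GoodSystem V)
    {S : Matrix (Fin 4) (Fin 4) ℂ} (hS : IsUnit S) : GoodSystem (substSystem S V) where
  hom := by
    rintro _ ⟨f, hf, rfl⟩
    exact subst_isHomogeneous S (hV.hom f hf)
  finrank_eq := by
    rw [← hV.finrank_eq]
    exact (LinearEquiv.finrank_eq
      (Submodule.equivMapOfInjective (QuadBir.subst S).toLinearMap (subst_injective hS) V)).symm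
  inj := by
    obtain ⟨D, hD, h⟩ := hV.inj
    have hdet := (Matrix.isUnit_iff_isUnit_det S).mp hS
    refine ⟨QuadBir.subst S D, fun h0 => hD (subst_injective hS (by rw [h0, map_zero])), ?_⟩
    intro x x' c hx hc hf
    rw [eval_subst] at hx
    obtain ⟨t, ht⟩ := h (S.mulVec x) (S.mulVec x') c hx hc (fun f hfV => by
      have := hf _ (mem_substSystem hfV)
      rwa [eval_subst, eval_subst] at this)
    refine ⟨t, ?_⟩
    have := congrArg (S⁻¹.mulVec) ht
    rwa [Matrix.mulVec_smul, Matrix.mulVec_mulVec, Matrix.mulVec_mulVec,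
      Matrix.nonsing_inv_mul _ hdet, Matrix.one_mulVec, Matrix.one_mulVec] at this
  red := by
    intro f d n hf hn x hx hg
    have hdet := (Matrix.isUnit_iff_isUnit_det S).mp hS
    have key := hV.red (QuadBir.subst S⁻¹ f) d n (subst_isHomogeneous _ hf) (by
      have := Ideal.mem_map_of_mem (QuadBir.subst S⁻¹).toRingHom hn
      rw [Ideal.map_span] at this
      rw [← map_pow]
      refine (Ideal.span_mono ?_) this
      rintro _ ⟨g, hg', rfl⟩
      exact subst_inv_mem hS hg')
      (fun i => ∑ j, S i j • x j) ?_ ?_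
    · rwa [← aeval_subst, subst_subst_inv hS] at key
    · by_contra! h0
      obtain ⟨i, hi⟩ := hx
      apply hi
      have h1 : S.mulVec (fun j => (x j).fst) = 0 := by
        ext i
        have := h0 i
        rw [TrivSqZeroExt.fst_sum] at this
        simpa [Matrix.mulVec, dotProduct] using this
      have h2 := congrArg (S⁻¹.mulVec) h1
      rw [Matrix.mulVec_mulVec, Matrix.nonsing_inv_mul _ hdet, Matrix.one_mulVec,
        Matrix.mulVec_zero] at h2
      exact congrFun h2 i
    · intro g hgV
      rw [← aeval_subst]
      exact hg _ (mem_substSystem hgV)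
  base := by
    obtain ⟨p, hp, h⟩ := hV.base
    have hdet := (Matrix.isUnit_iff_isUnit_det S).mp hS
    have hpp : S.mulVec (S⁻¹.mulVec p) = p := by
      rw [Matrix.mulVec_mulVec, Matrix.mul_nonsing_inv _ hdet, Matrix.one_mulVec]
    refine ⟨S⁻¹.mulVec p, fun h0 => hp ?_, ?_⟩
    · rw [← hpp, h0, Matrix.mulVec_zero]
    · rintro _ ⟨f, hf, rfl⟩
      simpa [eval_subst, hpp] using h f hf

theorem isUnit_inv {k : ℕ} {T : Matrix (Fin k) (Fin k) ℂ} (hT : IsUnit T) : IsUnit T⁻¹ :=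
   Matrix.isUnit_nonsing_inv_iff.mpr hT

theorem subst_mul_inv_mem {S : Matrix (Fin 4) (Fin 4) ℂ} (hS : IsUnit S)
    (T : Matrix (Fin 4) (Fin 4) ℂ) {V : Submodule ℂ (MvPolynomial (Fin 4) ℂ)}
    {f : MvPolynomial (Fin 4) ℂ} (hf : subst T f ∈ substSystem S V) : subst (T * S⁻¹) f ∈ V := by
  have := subst_inv_mem hS hf
  rwa [subst_subst] at this

theorem IsLineType.of_subst {V : Submodule ℂ (MvPolynomial (Fin 4) ℂ)}
    {S : Matrix (Fin 4) (Fin 4) ℂ} (hS : IsUnit S) (h : IsLineType (substSystem S V)) :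
    IsLineType V := by
  obtain ⟨T, hT, h1, h2, h3, h4, h5⟩ := h
  exact ⟨T * S⁻¹, hT.mul (isUnit_inv hS), subst_mul_inv_mem hS T h1, subst_mul_inv_mem hS T h2,
    subst_mul_inv_mem hS T h3, subst_mul_inv_mem hS T h4, subst_mul_inv_mem hS T h5⟩

theorem IsConicType.of_subst {V : Submodule ℂ (MvPolynomial (Fin 4) ℂ)}
    {S : Matrix (Fin 4) (Fin 4) ℂ} (hS : IsUnit S) (h : IsConicType (substSystem S V)) :
    IsConicType V := by
  obtain ⟨m, hm, h⟩ := h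
  refine ⟨subst S⁻¹ m,
    fun h0 => hm (subst_injective (isUnit_inv hS) (by rw [h0, map_zero])), fun i => ?_⟩
  have h1 : ∀ v, m * linForm v ∈ substSystem S V := by
    intro v
    rw [linForm_apply, Finset.mul_sum]
    refine Submodule.sum_mem _ fun j _ => ?_
    rw [mul_smul_comm]
    exact Submodule.smul_mem _ _ (h j)
  have h2 := subst_inv_mem hS (h1 (S i))
  rwa [map_mul, ← subst_X, subst_inv_subst hS] at h2

/-! ### Tangent vectors of the base scheme. -/

/-- The tangent vector `w` at `p`. -/
noncomputable def dualPoint {k : ℕ} (p w : Fin k → ℂ) : Fin k → DualNumber ℂ :=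
  fun i => TrivSqZeroExt.inl (p i) + TrivSqZeroExt.inr (w i)

/-- A linear form that is nilpotent on a reduced scheme is zero on it, so it kills all tangent
vectors. The case analysis uses reducedness only in this way. -/
theorem GoodSystem.dotProduct_eq_zero {V : Submodule ℂ (MvPolynomial (Fin 4) ℂ)}
    (hV : GoodSystem V) {v : Fin 4 → ℂ} {n : ℕ}
    (hv : linForm v ^ n ∈ Ideal.span (V : Set (MvPolynomial (Fin 4) ℂ))) {p w : Fin 4 → ℂ}
    (hp : p ≠ 0) (h : V ≤ LinearMap.ker (aeval (R := ℂ) (dualPoint p w)).toLinearMap) :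
    v ⬝ᵥ w = 0 := by
  have h1 := hV.red (linForm v) 1 n (linForm_isHomogeneous v) hv (dualPoint p w) (by
    obtain ⟨i, hi⟩ := Function.ne_iff.mp hp
    exact ⟨i, by simpa [dualPoint] using hi⟩) (fun g hg => by simpa using h hg)
  rw [aeval_linForm] at h1
  have h2 := congrArg TrivSqZeroExt.snd h1
  rw [TrivSqZeroExt.snd_sum] at h2
  simpa [dualPoint, dotProduct] using h2

theorem GoodSystem.coord_eq_zero {V : Submodule ℂ (MvPolynomial (Fin 4) ℂ)}
    (hV : GoodSystem V) {i : Fin 4} {n : ℕ}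
    (hv : X i ^ n ∈ Ideal.span (V : Set (MvPolynomial (Fin 4) ℂ))) {p w : Fin 4 → ℂ}
    (hp : p ≠ 0) (h : V ≤ LinearMap.ker (aeval (R := ℂ) (dualPoint p w)).toLinearMap) :
    w i = 0 := by
  rw [← linForm_single] at hv
  simpa using hV.dotProduct_eq_zero hv hp h

/-- Members of `V` found by factorization are completed to a basis, so that only `5 - j` generators
remain unknown. -/
theorem GoodSystem.exists_generators {V : Submodule ℂ (MvPolynomial (Fin 4) ℂ)}
    (hV : GoodSystem V) {j : ℕ} {f : Fin j → MvPolynomial (Fin 4) ℂ}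
    (hf : LinearIndependent ℂ f) (hfV : ∀ i, f i ∈ V) :
    ∃ (g : Fin 5 → MvPolynomial (Fin 4) ℂ) (h : j ≤ 5), LinearIndependent ℂ g ∧
      Submodule.span ℂ (Set.range g) = V ∧ ∀ i, g (Fin.castLE h i) = f i := by
  have : FiniteDimensional ℂ V := .of_finrank_pos (by rw [hV.finrank_eq]; norm_num)
  have hj : j ≤ 5 := by
    have hf' : LinearIndependent ℂ (fun i => (⟨f i, hfV i⟩ : V)) :=
      LinearIndependent.of_comp V.subtype hf
    simpa [hV.finrank_eq] using hf'.fintype_card_le_finrank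
  obtain ⟨d, hd⟩ : ∃ d, 5 = j + d := ⟨5 - j, by omega⟩
  induction d generalizing j with
  | zero =>
    obtain rfl : 5 = j := by omega
    refine ⟨f, le_rfl, hf, ?_, fun i => rfl⟩
    refine Submodule.eq_of_le_of_finrank_eq (Submodule.span_le.mpr ?_) ?_
    · rintro _ ⟨i, rfl⟩
      exact hfV i
    · rw [finrank_span_eq_card hf, hV.finrank_eq, Fintype.card_fin]
  | succ d ih =>
    have hf' : LinearIndependent ℂ (fun i => (⟨f i, hfV i⟩ : V)) :=
      LinearIndependent.of_comp V.subtype hf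
    obtain ⟨x, hx⟩ := exists_linearIndependent_snoc_of_lt_finrank (R := ℂ) hf'
      (by rw [hV.finrank_eq]; omega)
    have hx' := hx.map' V.subtype V.ker_subtype
    obtain ⟨g, h, hg, hs, hgv⟩ := ih hx' (fun i => Subtype.coe_prop _) (by omega) (by omega)
    refine ⟨g, hj, hg, hs, fun i => ?_⟩
    have := hgv i.castSucc
    simpa using this

theorem exists_quadratic_zero (a b c : ℂ) :
    ∃ s t : ℂ, (s ≠ 0 ∨ t ≠ 0) ∧ a * s ^ 2 + b * (s * t) + c * t ^ 2 = 0 := by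
  by_cases ha : a = 0
  · exact ⟨1, 0, by simp [ha]⟩
  · obtain ⟨r, hr⟩ := IsAlgClosed.exists_pow_nat_eq (discrim a b c) (n := 2) (by norm_num)
    obtain ⟨x, hx⟩ := exists_quadratic_eq_zero ha ⟨r, by rw [← hr, sq]⟩
    exact ⟨x, 1, by simp, by linear_combination hx⟩

theorem exists_linear_factors (a b c : ℂ) :
    ∃ s t s' t' : ℂ, a = s * s' ∧ b = s * t' + t * s' ∧ c = t * t' := by
  by_cases ha : a = 0
  · exact ⟨0, 1, b, c, by simp [ha]⟩
  · obtain ⟨r, hr⟩ := IsAlgClosed.exists_pow_nat_eq (discrim a b c) (n := 2) (by norm_num)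
    obtain ⟨x, hx⟩ := exists_quadratic_eq_zero ha ⟨r, by rw [← hr, sq]⟩
    exact ⟨1, -x, a, b + a * x, by ring, by ring, by linear_combination hx⟩

theorem exists_quadric_coeffs {f : MvPolynomial (Fin 4) ℂ} (hf : f.IsHomogeneous 2) :
    ∃ c : Fin 10 → ℂ, f = C (c 0) * X 0 ^ 2 + C (c 1) * (X 0 * X 1) + C (c 2) * (X 0 * X 2) +
      C (c 3) * (X 0 * X 3) + C (c 4) * X 1 ^ 2 + C (c 5) * (X 1 * X 2) + C (c 6) * (X 1 * X 3) +
      C (c 7) * X 2 ^ 2 + C (c 8) * (X 2 * X 3) + C (c 9) * X 3 ^ 2 := by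
  obtain ⟨c, rfl⟩ := exists_eq_sum_of_isHomogeneous_two hf
  refine ⟨![c 0 0, c 0 1 + c 1 0, c 0 2 + c 2 0, c 0 3 + c 3 0, c 1 1, c 1 2 + c 2 1,
    c 1 3 + c 3 1, c 2 2, c 2 3 + c 3 2, c 3 3], ?_⟩
  simp [Fin.sum_univ_four, smul_eq_C_mul]
  ring

/-- The polynomials that take at `x'` the value they take at `x`, multiplied by `c`. -/
noncomputable def proportionalAt (x x' : Fin 4 → ℂ) (c : ℂ) :
    Submodule ℂ (MvPolynomial (Fin 4) ℂ) :=
  LinearMap.ker ((aeval (R := ℂ) x').toLinearMap - c • (aeval (R := ℂ) x).toLinearMap)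

theorem mem_proportionalAt {x x' : Fin 4 → ℂ} {c : ℂ} {f : MvPolynomial (Fin 4) ℂ} :
    f ∈ proportionalAt x x' c ↔ eval x' f = c * eval x f := by
  simp [proportionalAt, sub_eq_zero, aeval_eq_eval]

/-- The polynomials that vanish along the tangent vector `w` at `p`. -/
noncomputable def vanishingAlong (p w : Fin 4 → ℂ) : Submodule ℂ (MvPolynomial (Fin 4) ℂ) :=
  LinearMap.ker (aeval (R := ℂ) (dualPoint p w)).toLinearMap

theorem mem_vanishingAlong {p w : Fin 4 → ℂ} {f : MvPolynomial (Fin 4) ℂ} :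
    f ∈ vanishingAlong p w ↔ (aeval (dualPoint p w) f).fst = 0 ∧
      (aeval (dualPoint p w) f).snd = 0 := by
  rw [vanishingAlong, LinearMap.mem_ker, TrivSqZeroExt.ext_iff]
  rfl

@[simp]
theorem dualPoint_fst (p w : Fin 4 → ℂ) (i : Fin 4) : (dualPoint p w i).fst = p i := by
  simp [dualPoint]

@[simp]
theorem dualPoint_snd (p w : Fin 4 → ℂ) (i : Fin 4) : (dualPoint p w i).snd = w i := by
  simp [dualPoint]

@[simp]
theorem fst_algebraMap_dual (a : ℂ) :
    TrivSqZeroExt.fst (algebraMap ℂ (DualNumber ℂ) a) = a := by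
  simp [TrivSqZeroExt.algebraMap_eq_inl]

@[simp]
theorem snd_algebraMap_dual (a : ℂ) :
    TrivSqZeroExt.snd (algebraMap ℂ (DualNumber ℂ) a) = 0 := by
  simp [TrivSqZeroExt.algebraMap_eq_inl]

theorem C_mul_mem {k : ℕ} {W : Submodule ℂ (MvPolynomial (Fin k) ℂ)} {f : MvPolynomial (Fin k) ℂ}
    (hf : f ∈ W) (a : ℂ) : C a * f ∈ W := by
  rw [← smul_eq_C_mul]
  exact W.smul_mem a hf

/-! ### Quadrics through two skew lines. -/

/-- The binary form splits into two linear factors. If they are independent, they serve as new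
coordinates `X 0`, `X 1`; if they are proportional, the base scheme has a double point on the line
`X 2 = X 3 = 0`, against reducedness. -/
theorem isLineType_of_binary {V : Submodule ℂ (MvPolynomial (Fin 4) ℂ)} (hV : GoodSystem V)
    (h02 : X 0 * X 2 ∈ V) (h03 : X 0 * X 3 ∈ V) (h12 : X 1 * X 2 ∈ V) (h13 : X 1 * X 3 ∈ V)
    {a b c : ℂ} (hP : C a * X 0 ^ 2 + C b * (X 0 * X 1) + C c * X 1 ^ 2 ∈ V)
    (hP0 : ¬ (a = 0 ∧ b = 0 ∧ c = 0))
    (hgen : ∀ W : Submodule ℂ (MvPolynomial (Fin 4) ℂ), X 0 * X 2 ∈ W → X 0 * X 3 ∈ W →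
      X 1 * X 2 ∈ W → X 1 * X 3 ∈ W →
      C a * X 0 ^ 2 + C b * (X 0 * X 1) + C c * X 1 ^ 2 ∈ W → V ≤ W) : IsLineType V := by
  obtain ⟨s, t, s', t', rfl, rfl, rfl⟩ := exists_linear_factors a b c
  by_cases hdet : s * t' - t * s' = 0
  · exfalso
    obtain ⟨k, hk, rfl, rfl⟩ : ∃ k, k ≠ 0 ∧ s' = k * s ∧ t' = k * t := by
      by_cases hs : s = 0
      · subst hs
        have ht : t ≠ 0 := fun ht => hP0 (by simp [ht])
        have hs' : s' = 0 := by simpa [ht] using hdet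
        exact ⟨t' / t, fun h => hP0 (by simp [hs', div_eq_zero_iff, ht] at h ⊢; simp [h]),
          by simp [hs'], by field_simp⟩
      · have ht' : t' = t * s' / s := by field_simp; linear_combination hdet
        exact ⟨s' / s, fun h => hP0 (by simp [div_eq_zero_iff, hs] at h; simp [h, ht']),
          by field_simp, by rw [ht']; field_simp⟩
    have hI : linForm ![s, t, 0, 0] ^ 2 ∈ Ideal.span (V : Set (MvPolynomial (Fin 4) ℂ)) := by
      have : linForm ![s, t, 0, 0] ^ 2 = C k⁻¹ * (C (s * (k * s)) * X 0 ^ 2 +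
          C (s * (k * t) + t * (k * s)) * (X 0 * X 1) + C (t * (k * t)) * X 1 ^ 2) := by
        have h1 : (C k⁻¹ : MvPolynomial (Fin 4) ℂ) * C k = 1 := by
          rw [← C_mul, inv_mul_cancel₀ hk, C_1]
        simp [linForm_apply, Fin.sum_univ_four, smul_eq_C_mul]
        linear_combination -(C s * X 0 + C t * X 1) ^ 2 * h1
      rw [this]
      exact Ideal.mul_mem_left _ _ (Ideal.subset_span hP)
    have hst : s ≠ 0 ∨ t ≠ 0 := by
      by_contra! h
      exact hP0 (by simp [h])
    have hp : ![t, -s, 0, 0] ≠ 0 := by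
      intro h
      rcases hst with h' | h'
      · exact h' (by simpa using congrFun h 1)
      · exact h' (by simpa using congrFun h 0)
    -- The four products vanish identically on `X 2 = X 3 = 0`, and the square vanishes doubly at
    -- this point, so every direction within that line is tangent.
    have key : ∀ u v : ℂ, V ≤ vanishingAlong ![t, -s, 0, 0] ![u, v, 0, 0] := by
      intro u v
      apply hgen <;> rw [mem_vanishingAlong]
      · simp
      · simp
      · simp
      · simp
      · constructor
        · simp
          ring
        · simp [pow_two]
          ring
    have h1 := hV.dotProduct_eq_zero hI hp (key 1 0)
    have h2 := hV.dotProduct_eq_zero hI hp (key 0 1)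
    simp [dotProduct, Fin.sum_univ_four] at h1 h2
    tauto
  · have hT : IsUnit (!![s, t, 0, 0; s', t', 0, 0; 0, 0, 1, 0; 0, 0, 0, 1] :
        Matrix (Fin 4) (Fin 4) ℂ) := by
      rw [Matrix.isUnit_iff_isUnit_det, isUnit_iff_ne_zero]
      have : (!![s, t, 0, 0; s', t', 0, 0; 0, 0, 1, 0; 0, 0, 0, 1] :
        Matrix (Fin 4) (Fin 4) ℂ).det = s * t' - t * s' := by
        simp [Matrix.det_succ_row_zero, Fin.sum_univ_succ, Fin.succAbove]
        ring
      rwa [this]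
    refine ⟨_, hT, ?_, ?_, ?_, ?_, ?_⟩
    · convert V.add_mem (C_mul_mem h02 s) (C_mul_mem h12 t) using 1
      simp [subst_X, linForm_apply, Fin.sum_univ_four, smul_eq_C_mul]
      ring
    · convert V.add_mem (C_mul_mem h03 s) (C_mul_mem h13 t) using 1
      simp [subst_X, linForm_apply, Fin.sum_univ_four, smul_eq_C_mul]
      ring
    · convert V.add_mem (C_mul_mem h02 s') (C_mul_mem h12 t') using 1
      simp [subst_X, linForm_apply, Fin.sum_univ_four, smul_eq_C_mul]
      ring
    · convert V.add_mem (C_mul_mem h03 s') (C_mul_mem h13 t') using 1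
      simp [subst_X, linForm_apply, Fin.sum_univ_four, smul_eq_C_mul]
      ring
    · convert hP using 1
      simp [subst_X, linForm_apply, Fin.sum_univ_four, smul_eq_C_mul]
      ring

theorem linearIndependent_skew : LinearIndependent ℂ
    (![X 0 * X 2, X 0 * X 3, X 1 * X 2, X 1 * X 3] : Fin 4 → MvPolynomial (Fin 4) ℂ) := by
  rw [Fintype.linearIndependent_iff]
  intro g hg
  have h1 := congrArg (eval ![1, 0, 1, 0]) hg
  have h2 := congrArg (eval ![1, 0, 0, 1]) hg
  have h3 := congrArg (eval ![0, 1, 1, 0]) hg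
  have h4 := congrArg (eval ![0, 1, 0, 1]) hg
  simp [Fin.sum_univ_four, smul_eval] at h1 h2 h3 h4
  intro i
  fin_cases i <;> simpa

theorem linearIndependent_meeting : LinearIndependent ℂ
    (![X 0 ^ 2, X 0 * X 1, X 0 * X 2, X 1 * X 2] : Fin 4 → MvPolynomial (Fin 4) ℂ) := by
  rw [Fintype.linearIndependent_iff]
  intro g hg
  have h1 := congrArg (eval ![1, 0, 0, 0]) hg
  have h2 := congrArg (eval ![1, 1, 0, 0]) hg
  have h3 := congrArg (eval ![1, 0, 1, 0]) hg
  have h4 := congrArg (eval ![0, 1, 1, 0]) hg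
  simp [Fin.sum_univ_four, smul_eval] at h1 h2 h3 h4
  simp [h1] at h2 h3
  intro i
  fin_cases i <;> simpa

theorem linearIndependent_double : LinearIndependent ℂ
    (![X 0 ^ 2, X 0 * X 1, X 1 ^ 2] : Fin 3 → MvPolynomial (Fin 4) ℂ) := by
  rw [Fintype.linearIndependent_iff]
  intro g hg
  have h1 := congrArg (eval ![1, 0, 0, 0]) hg
  have h2 := congrArg (eval ![1, 1, 0, 0]) hg
  have h3 := congrArg (eval ![0, 1, 0, 0]) hg
  simp [Fin.sum_univ_three, smul_eval] at h1 h2 h3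
  simp [h1, h3] at h2
  intro i
  fin_cases i <;> simpa

/-- Modulo the four products the fifth quadric is `P(X 0, X 1) + Q(X 2, X 3)`. If both parts were
nonzero, the map would factor generically through an involution, so exactly one of them vanishes. -/
theorem isLineType_of_skew {V : Submodule ℂ (MvPolynomial (Fin 4) ℂ)} (hV : GoodSystem V)
    (h02 : X 0 * X 2 ∈ V) (h03 : X 0 * X 3 ∈ V) (h12 : X 1 * X 2 ∈ V) (h13 : X 1 * X 3 ∈ V) :
    IsLineType V := by
  obtain ⟨g, _, hg, hs, hgv⟩ := hV.exists_generators linearIndependent_skew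
    (fun i => by fin_cases i <;> simpa)
  have g0 : g 0 = X 0 * X 2 := hgv 0
  have g1 : g 1 = X 0 * X 3 := hgv 1
  have g2 : g 2 = X 1 * X 2 := hgv 2
  have g3 : g 3 = X 1 * X 3 := hgv 3
  have g4V : g 4 ∈ V := hs ▸ Submodule.subset_span ⟨4, rfl⟩
  obtain ⟨c, hc⟩ := exists_quadric_coeffs (hV.hom _ g4V)
  set P : MvPolynomial (Fin 4) ℂ := C (c 0) * X 0 ^ 2 + C (c 1) * (X 0 * X 1) + C (c 4) * X 1 ^ 2
    with hP
  set Q : MvPolynomial (Fin 4) ℂ := C (c 7) * X 2 ^ 2 + C (c 8) * (X 2 * X 3) + C (c 9) * X 3 ^ 2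
    with hQ
  have hPQ : g 4 = P + Q + C (c 2) * (X 0 * X 2) + C (c 3) * (X 0 * X 3) + C (c 5) * (X 1 * X 2) +
      C (c 6) * (X 1 * X 3) := by
    rw [hc]
    ring
  have hgen : ∀ W : Submodule ℂ (MvPolynomial (Fin 4) ℂ), X 0 * X 2 ∈ W → X 0 * X 3 ∈ W →
      X 1 * X 2 ∈ W → X 1 * X 3 ∈ W → P + Q ∈ W → V ≤ W := by
    intro W h0 h1 h2 h3 h4
    rw [← hs, Submodule.span_le]
    rintro _ ⟨i, rfl⟩
    fin_cases i
    · exact g0 ▸ h0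
    · exact g1 ▸ h1
    · exact g2 ▸ h2
    · exact g3 ▸ h3
    · change g 4 ∈ W
      rw [hPQ]
      exact W.add_mem (W.add_mem (W.add_mem (W.add_mem h4 (C_mul_mem h0 _)) (C_mul_mem h1 _))
        (C_mul_mem h2 _)) (C_mul_mem h3 _)
  have hPQV : P + Q ∈ V := by
    have : P + Q = g 4 - C (c 2) * (X 0 * X 2) - C (c 3) * (X 0 * X 3) - C (c 5) * (X 1 * X 2) -
      C (c 6) * (X 1 * X 3) := by
      rw [hPQ]
      ring
    rw [this]
    exact V.sub_mem (V.sub_mem (V.sub_mem (V.sub_mem g4V (C_mul_mem h02 _)) (C_mul_mem h03 _))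
        (C_mul_mem h12 _)) (C_mul_mem h13 _)
  have hne : ¬ (P = 0 ∧ Q = 0) := by
    rintro ⟨h1, h2⟩
    have := Fintype.linearIndependent_iff.mp hg ![c 2, c 3, c 5, c 6, -1] (by
      simp [Fin.sum_univ_five, g0, g1, g2, g3, smul_eq_C_mul]
      rw [hPQ, h1, h2]
      ring) 4
    simp at this
  by_cases hQ0 : Q = 0
  · rw [hQ0, add_zero] at hPQV hgen
    refine isLineType_of_binary hV h02 h03 h12 h13 hPQV ?_ hgen
    rintro ⟨h1, h2, h3⟩
    exact hne ⟨by simp [hP, h1, h2, h3], hQ0⟩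
  by_cases hP0 : P = 0
  · rw [hP0, zero_add] at hPQV hgen
    -- Exchanging the two lines reduces to the case `Q = 0`.
    set S : Matrix (Fin 4) (Fin 4) ℂ := !![0, 0, 1, 0; 0, 0, 0, 1; 1, 0, 0, 0; 0, 1, 0, 0] with hS
    have hSS : S * S = 1 := by
      ext i j
      fin_cases i <;> fin_cases j <;> simp [hS, Matrix.mul_apply, Fin.sum_univ_four]
    have hSu : IsUnit S := IsUnit.of_mul_eq_one S hSS
    have s0 : subst S (X 0) = X 2 := by
      simp [subst_X, hS, linForm_apply, Fin.sum_univ_four]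
    have s1 : subst S (X 1) = X 3 := by
      simp [subst_X, hS, linForm_apply, Fin.sum_univ_four]
    have s2 : subst S (X 2) = X 0 := by
      simp [subst_X, hS, linForm_apply, Fin.sum_univ_four]
    have s3 : subst S (X 3) = X 1 := by
      simp [subst_X, hS, linForm_apply, Fin.sum_univ_four]
    have sC : ∀ a : ℂ, subst S (C a) = C a := fun a => (subst S).commutes a
    have sQ : subst S Q = C (c 7) * X 0 ^ 2 + C (c 8) * (X 0 * X 1) + C (c 9) * X 1 ^ 2 := by
      simp [hQ, s2, s3, sC]
    refine IsLineType.of_subst hSu (isLineType_of_binary (a := c 7) (b := c 8) (c := c 9)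
      (hV.subst hSu) ?_ ?_ ?_ ?_ ?_ ?_ ?_)
    · simpa [s0, s2, mul_comm] using mem_substSystem (S := S) h02
    · simpa [s1, s2, mul_comm] using mem_substSystem (S := S) h12
    · simpa [s0, s3, mul_comm] using mem_substSystem (S := S) h03
    · simpa [s1, s3, mul_comm] using mem_substSystem (S := S) h13
    · rw [← sQ]
      exact mem_substSystem hPQV
    · rintro ⟨h1, h2, h3⟩
      exact hQ0 (by simp [hQ, h1, h2, h3])
    · intro W k02 k03 k12 k13 kQ
      rw [substSystem, Submodule.map_le_iff_le_comap]
      refine hgen _ ?_ ?_ ?_ ?_ ?_ <;> simp only [Submodule.mem_comap, AlgHom.toLinearMap_apply]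
      · simpa [s0, s2, mul_comm] using k02
      · simpa [s0, s3, mul_comm] using k12
      · simpa [s1, s2, mul_comm] using k03
      · simpa [s1, s3, mul_comm] using k13
      · rwa [sQ]
  exfalso
  obtain ⟨D, hD, hinj⟩ := hV.inj
  have hsub : P - Q ≠ 0 := by
    intro h
    apply hP0
    apply MvPolynomial.funext
    intro x
    have := congrArg (eval ![x 0, x 1, 0, 0]) h
    simpa [hP, hQ] using this
  obtain ⟨x, hx⟩ := exists_eval_ne_zero (mul_ne_zero (mul_ne_zero (mul_ne_zero (mul_ne_zero
    (mul_ne_zero hD hP0) hQ0) hsub) (X_ne_zero 0)) (X_ne_zero 2))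
  simp only [map_mul, mul_ne_zero_iff, map_sub, eval_X] at hx
  obtain ⟨⟨⟨⟨⟨hxD, hxP⟩, hxQ⟩, hxs⟩, hx0⟩, hx2⟩ := hx
  -- The involution `(Q x₀, Q x₁, P x₂, P x₃)` multiplies the four products by `PQ`, and also `P +
  -- Q`, which goes to `Q²P + P²Q`. It moves `x` wherever `P ≠ Q` and `x₀ x₂ ≠ 0`.
  obtain ⟨t, ht⟩ := hinj x ![eval x Q * x 0, eval x Q * x 1, eval x P * x 2, eval x P * x 3]
    (eval x P * eval x Q) hxD (mul_ne_zero hxP hxQ) (fun f hf => by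
      refine mem_proportionalAt.mp (hgen (proportionalAt _ _ _) ?_ ?_ ?_ ?_ ?_ hf) <;>
        rw [mem_proportionalAt]
      · simp; ring
      · simp; ring
      · simp; ring
      · simp; ring
      · have h1 : ∀ y : Fin 4 → ℂ, eval y (P + Q) = c 0 * y 0 ^ 2 + c 1 * (y 0 * y 1) +
            c 4 * y 1 ^ 2 + (c 7 * y 2 ^ 2 + c 8 * (y 2 * y 3) + c 9 * y 3 ^ 2) := by
          intro y
          simp [hP, hQ]
        have hPx : eval x P = c 0 * x 0 ^ 2 + c 1 * (x 0 * x 1) + c 4 * x 1 ^ 2 := by simp [hP]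
        have hQx : eval x Q = c 7 * x 2 ^ 2 + c 8 * (x 2 * x 3) + c 9 * x 3 ^ 2 := by simp [hQ]
        rw [h1, map_add (eval x) P Q]
        simp only [Matrix.cons_val]
        linear_combination -(eval x Q) ^ 2 * hPx - (eval x P) ^ 2 * hQx)
  have e0 := congrFun ht 0
  have e2 := congrFun ht 2
  simp only [Matrix.cons_val, Pi.smul_apply, smul_eq_mul] at e0 e2
  have e0' := mul_right_cancel₀ hx0 e0
  have e2' := mul_right_cancel₀ hx2 e2
  exact hxs (by rw [e0', e2', sub_self])

/-! ### Quadrics through two meeting lines. -/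

/-- If `X 3 ^ 2` occurs in the fifth quadric, the map identifies pairs of points on the lines
through `[0, 0, 0, 1]`. Otherwise that point is a base point, and reducedness there leaves only the
term `X 0 * X 3`. -/
theorem isConicType_of_meeting {V : Submodule ℂ (MvPolynomial (Fin 4) ℂ)} (hV : GoodSystem V)
    (h00 : X 0 ^ 2 ∈ V) (h01 : X 0 * X 1 ∈ V) (h02 : X 0 * X 2 ∈ V) (h12 : X 1 * X 2 ∈ V) :
    IsConicType V := by
  obtain ⟨g, _, hg, hs, hgv⟩ := hV.exists_generators linearIndependent_meeting
    (fun i => by fin_cases i <;> simpa)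
  have g0 : g 0 = X 0 ^ 2 := hgv 0
  have g1 : g 1 = X 0 * X 1 := hgv 1
  have g2 : g 2 = X 0 * X 2 := hgv 2
  have g3 : g 3 = X 1 * X 2 := hgv 3
  have g4V : g 4 ∈ V := hs ▸ Submodule.subset_span ⟨4, rfl⟩
  obtain ⟨c, hc⟩ := exists_quadric_coeffs (hV.hom _ g4V)
  obtain ⟨a, b, e0, e1, e2, e3, hf⟩ : ∃ a b e0 e1 e2 e3 : ℂ, C a * X 1 ^ 2 + C b * X 2 ^ 2 +
      C e0 * (X 0 * X 3) + C e1 * (X 1 * X 3) + C e2 * (X 2 * X 3) + C e3 * X 3 ^ 2 = g 4 -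
        (C (c 0) * X 0 ^ 2 + C (c 1) * (X 0 * X 1) + C (c 2) * (X 0 * X 2) +
          C (c 5) * (X 1 * X 2)) :=
    ⟨c 4, c 7, c 3, c 6, c 8, c 9, by rw [hc]; ring⟩
  have hsum : ∀ W : Submodule ℂ (MvPolynomial (Fin 4) ℂ), X 0 ^ 2 ∈ W → X 0 * X 1 ∈ W →
      X 0 * X 2 ∈ W → X 1 * X 2 ∈ W → C (c 0) * X 0 ^ 2 + C (c 1) * (X 0 * X 1) +
        C (c 2) * (X 0 * X 2) + C (c 5) * (X 1 * X 2) ∈ W := fun W k0 k1 k2 k3 =>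
    W.add_mem (W.add_mem (W.add_mem (C_mul_mem k0 _) (C_mul_mem k1 _)) (C_mul_mem k2 _))
      (C_mul_mem k3 _)
  set f : MvPolynomial (Fin 4) ℂ := C a * X 1 ^ 2 + C b * X 2 ^ 2 +
      C e0 * (X 0 * X 3) + C e1 * (X 1 * X 3) + C e2 * (X 2 * X 3) + C e3 * X 3 ^ 2 with hfdef
  have hfV : f ∈ V := hf ▸ V.sub_mem g4V (hsum V h00 h01 h02 h12)
  have hgen : ∀ W : Submodule ℂ (MvPolynomial (Fin 4) ℂ), X 0 ^ 2 ∈ W → X 0 * X 1 ∈ W →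
      X 0 * X 2 ∈ W → X 1 * X 2 ∈ W → f ∈ W → V ≤ W := by
    intro W k0 k1 k2 k3 k4
    rw [← hs, Submodule.span_le]
    rintro _ ⟨i, rfl⟩
    fin_cases i
    · exact g0 ▸ k0
    · exact g1 ▸ k1
    · exact g2 ▸ k2
    · exact g3 ▸ k3
    · have := W.add_mem k4 (hsum W k0 k1 k2 k3)
      rw [hf, sub_add_cancel] at this
      exact this
  have hf0 : f ≠ 0 := by
    intro h0
    rw [h0] at hf
    have := Fintype.linearIndependent_iff.mp hg ![c 0, c 1, c 2, c 5, -1] (by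
      simp [Fin.sum_univ_five, g0, g1, g2, g3, smul_eq_C_mul]
      linear_combination hf) 4
    simp at this
  have hfe : ∀ y : Fin 4 → ℂ, eval y f = a * y 1 ^ 2 + b * y 2 ^ 2 + e0 * (y 0 * y 3) +
      e1 * (y 1 * y 3) + e2 * (y 2 * y 3) + e3 * y 3 ^ 2 := by
    intro y
    simp [hfdef]
  by_cases he3 : e3 = 0
  · subst he3
    have hp : (![0, 0, 0, 1] : Fin 4 → ℂ) ≠ 0 := fun h => by simpa using congrFun h 3
    have tang : ∀ w : Fin 4 → ℂ, e0 * w 0 + e1 * w 1 + e2 * w 2 = 0 →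
        V ≤ vanishingAlong ![0, 0, 0, 1] w := by
      intro w hw
      apply hgen <;> rw [mem_vanishingAlong]
      · simp
      · simp
      · simp
      · simp
      · constructor
        · simp [hfdef]
        · simp [hfdef]
          linear_combination hw
    have hI0 : X 0 ^ 2 ∈ Ideal.span (V : Set (MvPolynomial (Fin 4) ℂ)) := Ideal.subset_span h00
    have he0 : e0 ≠ 0 := by
      intro h
      have := hV.coord_eq_zero hI0 hp (tang ![1, 0, 0, 0] (by simp [h]))
      simp at this
    have he1 : e1 = 0 := by
      have := hV.coord_eq_zero hI0 hp (tang ![e1, -e0, 0, 0] (by simp; ring))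
      simpa using this
    have he2 : e2 = 0 := by
      have := hV.coord_eq_zero hI0 hp (tang ![e2, 0, -e0, 0] (by simp; ring))
      simpa using this
    subst he1 he2
    have ha : a = 0 := by
      by_contra ha
      -- The direction `X 1` is tangent at the base point, since `f` has linear part `e0 * X 0`
      -- there. Thus `X 1` must not be nilpotent, which fails if `a ≠ 0`.
      have hI : X 1 ^ 3 ∈ Ideal.span (V : Set (MvPolynomial (Fin 4) ℂ)) := by
        have : (X 1 ^ 3 : MvPolynomial (Fin 4) ℂ) = C a⁻¹ * (X 1 * f - C b * X 2 * (X 1 * X 2) -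
            C e0 * X 3 * (X 0 * X 1)) := by
          have h1 : (C a⁻¹ : MvPolynomial (Fin 4) ℂ) * C a = 1 := by
            rw [← C_mul, inv_mul_cancel₀ ha, C_1]
          simp [hfdef]
          linear_combination -X 1 ^ 3 * h1
        rw [this]
        exact Ideal.mul_mem_left _ _ (sub_mem (sub_mem
          (Ideal.mul_mem_left _ _ (Ideal.subset_span hfV))
          (Ideal.mul_mem_left _ _ (Ideal.subset_span h12)))
          (Ideal.mul_mem_left _ _ (Ideal.subset_span h01)))
      have := hV.coord_eq_zero hI hp (tang ![0, 1, 0, 0] (by simp))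
      simp at this
    have hb : b = 0 := by
      by_contra hb
      have hI : X 2 ^ 3 ∈ Ideal.span (V : Set (MvPolynomial (Fin 4) ℂ)) := by
        have : (X 2 ^ 3 : MvPolynomial (Fin 4) ℂ) = C b⁻¹ * (X 2 * f - C a * X 1 * (X 1 * X 2) -
            C e0 * X 3 * (X 0 * X 2)) := by
          have h1 : (C b⁻¹ : MvPolynomial (Fin 4) ℂ) * C b = 1 := by
            rw [← C_mul, inv_mul_cancel₀ hb, C_1]
          simp [hfdef]
          linear_combination -X 2 ^ 3 * h1
        rw [this]
        exact Ideal.mul_mem_left _ _ (sub_mem (sub_mem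
          (Ideal.mul_mem_left _ _ (Ideal.subset_span hfV))
          (Ideal.mul_mem_left _ _ (Ideal.subset_span h12)))
          (Ideal.mul_mem_left _ _ (Ideal.subset_span h02)))
      have := hV.coord_eq_zero hI hp (tang ![0, 0, 1, 0] (by simp))
      simp at this
    refine ⟨X 0, X_ne_zero 0, fun i => ?_⟩
    fin_cases i
    · exact pow_two (X 0 : MvPolynomial (Fin 4) ℂ) ▸ h00
    · exact h01
    · exact h02
    · have := C_mul_mem hfV e0⁻¹
      simp [hfdef, ha, hb] at this
      rwa [← mul_assoc, ← C_mul, inv_mul_cancel₀ he0, C_1, one_mul] at this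
  · exfalso
    obtain ⟨D, hD, hinj⟩ := hV.inj
    -- This is the derivative of `f` by `X 3`; where it does not vanish, the two roots in `x₃` are
    -- distinct.
    have hlin : linForm ![e0, e1, e2, 2 * e3] ≠ 0 := fun h => he3 (by
      simpa using congrFun (linForm_eq_zero.mp h) 3)
    obtain ⟨x, hx⟩ := exists_eval_ne_zero (mul_ne_zero (mul_ne_zero hD hlin) (X_ne_zero 0))
    simp only [map_mul, mul_ne_zero_iff, eval_X, eval_linForm] at hx
    obtain ⟨⟨hxD, hxl⟩, hx0⟩ := hx
    -- The four products do not involve `X 3`, and `f` is quadratic in it: the second point carries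
    -- the other root, computed from the sum of the roots.
    obtain ⟨t, ht⟩ := hinj x
      ![x 0, x 1, x 2, -x 3 - (e0 * x 0 + e1 * x 1 + e2 * x 2) / e3] 1 hxD one_ne_zero
      (fun f' hf' => by
        refine mem_proportionalAt.mp (hgen (proportionalAt _ _ _) ?_ ?_ ?_ ?_ ?_ hf') <;>
          rw [mem_proportionalAt]
        · simp
        · simp
        · simp
        · simp
        · rw [hfe, hfe]
          simp only [Matrix.cons_val]
          field_simp
          ring)
    have q0 := congrFun ht 0
    have q3 := congrFun ht 3
    simp only [Matrix.cons_val, Pi.smul_apply, smul_eq_mul] at q0 q3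
    have ht1 : t = 1 := mul_right_cancel₀ hx0 (by rw [one_mul]; exact q0.symm)
    rw [ht1, one_mul] at q3
    apply hxl
    simp [dotProduct, Fin.sum_univ_four]
    field_simp at q3
    linear_combination -q3

/-! ### Systems containing the square of the ideal of a line. -/

theorem exists_ne_zero_of_two_equations (a b c a' b' c' : ℂ) : ∃ u v w : ℂ,
    (u ≠ 0 ∨ v ≠ 0 ∨ w ≠ 0) ∧ a * u + b * v + c * w = 0 ∧ a' * u + b' * v + c' * w = 0 := by
  obtain ⟨v, hv, h⟩ := Matrix.exists_mulVec_eq_zero_iff (M := !![a, b, c; a', b', c'; 0, 0, 0])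
    |>.mpr (by simp [Matrix.det_fin_three])
  have h0 := congrFun h 0
  have h1 := congrFun h 1
  simp [Matrix.mulVec, dotProduct, Fin.sum_univ_three] at h0 h1
  refine ⟨v 0, v 1, v 2, ?_, h0, h1⟩
  by_contra! hc
  exact hv (by ext i; fin_cases i <;> simp [hc])

/-- `X 0` and `X 1` are nilpotent on the base scheme, so no tangent vector may leave the line `X 0 =
X 1 = 0`. The two further quadrics cannot achieve this: they are first shown to vanish on the whole
line, and then their differentials are dependent in the normal directions at some point of it. -/
theorem not_double_line {V : Submodule ℂ (MvPolynomial (Fin 4) ℂ)} (hV : GoodSystem V)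
    (h00 : X 0 ^ 2 ∈ V) (h01 : X 0 * X 1 ∈ V) (h11 : X 1 ^ 2 ∈ V)
    (hbase : ∀ f ∈ V, eval ![0, 0, 1, 0] f = 0) : False := by
  obtain ⟨g, _, hg, hs, hgv⟩ := hV.exists_generators linearIndependent_double
    (fun i => by fin_cases i <;> simpa)
  have g0 : g 0 = X 0 ^ 2 := hgv 0
  have g1 : g 1 = X 0 * X 1 := hgv 1
  have g2 : g 2 = X 1 ^ 2 := hgv 2
  have red : ∀ i, g i ∈ V → ∃ a b c d β γ : ℂ, ∃ s ∈ Submodule.span ℂ {X 0 ^ 2, X 0 * X 1, X 1 ^ 2},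
      g i = X 0 * (C a * X 2 + C b * X 3) + X 1 * (C c * X 2 + C d * X 3) + C β * (X 2 * X 3) +
        C γ * X 3 ^ 2 + s := by
    intro i hi
    obtain ⟨c, hc⟩ := exists_quadric_coeffs (hV.hom _ hi)
    have h0 := hbase _ hi
    rw [hc] at h0
    simp at h0
    refine ⟨c 2, c 3, c 5, c 6, c 8, c 9,
      C (c 0) * X 0 ^ 2 + C (c 1) * (X 0 * X 1) + C (c 4) * X 1 ^ 2, ?_, ?_⟩
    · refine add_mem (add_mem ?_ ?_) ?_ <;> exact C_mul_mem (Submodule.subset_span (by simp)) _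
    · rw [hc, h0]
      simp
      ring
  obtain ⟨a, b, c, d, β, γ, s, hsm, hg3⟩ := red 3 (hs ▸ Submodule.subset_span ⟨3, rfl⟩)
  obtain ⟨a', b', c', d', β', γ', s', hsm', hg4⟩ := red 4 (hs ▸ Submodule.subset_span ⟨4, rfl⟩)
  have hle : ∀ W : Submodule ℂ (MvPolynomial (Fin 4) ℂ), X 0 ^ 2 ∈ W → X 0 * X 1 ∈ W →
      X 1 ^ 2 ∈ W → Submodule.span ℂ {X 0 ^ 2, X 0 * X 1, X 1 ^ 2} ≤ W := by
    intro W k0 k1 k2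
    rw [Submodule.span_le]
    rintro _ (rfl | rfl | rfl) <;> assumption
  set f : MvPolynomial (Fin 4) ℂ := X 0 * (C a * X 2 + C b * X 3) +
    X 1 * (C c * X 2 + C d * X 3) + C β * (X 2 * X 3) + C γ * X 3 ^ 2 with hf
  set f' : MvPolynomial (Fin 4) ℂ := X 0 * (C a' * X 2 + C b' * X 3) +
    X 1 * (C c' * X 2 + C d' * X 3) + C β' * (X 2 * X 3) + C γ' * X 3 ^ 2 with hf'
  have hfV : f ∈ V := by
    rw [← sub_eq_iff_eq_add.mpr hg3]
    exact V.sub_mem (hs ▸ Submodule.subset_span ⟨3, rfl⟩) (hle V h00 h01 h11 hsm)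
  have hfV' : f' ∈ V := by
    rw [← sub_eq_iff_eq_add.mpr hg4]
    exact V.sub_mem (hs ▸ Submodule.subset_span ⟨4, rfl⟩) (hle V h00 h01 h11 hsm')
  have hgen : ∀ W : Submodule ℂ (MvPolynomial (Fin 4) ℂ), X 0 ^ 2 ∈ W → X 0 * X 1 ∈ W →
      X 1 ^ 2 ∈ W → f ∈ W → f' ∈ W → V ≤ W := by
    intro W k0 k1 k2 k3 k4
    rw [← hs, Submodule.span_le]
    rintro _ ⟨i, rfl⟩
    fin_cases i
    · exact g0 ▸ k0
    · exact g1 ▸ k1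
    · exact g2 ▸ k2
    · exact hg3 ▸ W.add_mem k3 (hle W k0 k1 k2 hsm)
    · exact hg4 ▸ W.add_mem k4 (hle W k0 k1 k2 hsm')
  have hI0 : X 0 ^ 2 ∈ Ideal.span (V : Set (MvPolynomial (Fin 4) ℂ)) := Ideal.subset_span h00
  have hI1 : X 1 ^ 2 ∈ Ideal.span (V : Set (MvPolynomial (Fin 4) ℂ)) := Ideal.subset_span h11
  have hI01 : X 0 * X 1 ∈ Ideal.span (V : Set (MvPolynomial (Fin 4) ℂ)) := Ideal.subset_span h01
  have hp : (![0, 0, 1, 0] : Fin 4 → ℂ) ≠ 0 := fun h => by simpa using congrFun h 2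
  have tang : ∀ u v w : ℂ, a * u + c * v + β * w = 0 → a' * u + c' * v + β' * w = 0 →
      V ≤ vanishingAlong ![0, 0, 1, 0] ![u, v, 0, w] := by
    intro u v w h h'
    apply hgen <;> rw [mem_vanishingAlong]
    · simp
    · simp
    · simp
    · constructor
      · simp [hf]
      · simp [hf]
        linear_combination h
    · constructor
      · simp [hf']
      · simp [hf']
        linear_combination h'
  -- Two linear conditions on `(u, v, w)` leave a nonzero tangent vector. It must have `u = v = 0`,
  -- so it points along the line and kills the coefficients of `w`.
  have hβ : β = 0 ∧ β' = 0 := by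
    obtain ⟨u, v, w, hne, h, h'⟩ := exists_ne_zero_of_two_equations a c β a' c' β'
    have hu := hV.coord_eq_zero hI0 hp (tang u v w h h')
    have hv := hV.coord_eq_zero hI1 hp (tang u v w h h')
    simp only [Matrix.cons_val] at hu hv
    subst hu hv
    have hw : w ≠ 0 := by simpa using hne
    exact ⟨by simpa [hw] using h, by simpa [hw] using h'⟩
  obtain ⟨rfl, rfl⟩ := hβ
  have hX3 : ∀ (n : ℕ), X 3 ^ n ∉ Ideal.span (V : Set (MvPolynomial (Fin 4) ℂ)) := by
    intro n hn
    have := hV.coord_eq_zero hn hp (tang 0 0 1 (by simp) (by simp))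
    simp at this
  have hγ : ∀ (h : MvPolynomial (Fin 4) ℂ) (a b c d e : ℂ), h ∈ V →
      h = X 0 * (C a * X 2 + C b * X 3) + X 1 * (C c * X 2 + C d * X 3) + C 0 * (X 2 * X 3) +
        C e * X 3 ^ 2 → e = 0 := by
    intro h a b c d e hh heq
    by_contra he
    apply hX3 4
    have h1 : (C e⁻¹ : MvPolynomial (Fin 4) ℂ) * C e = 1 := by
      rw [← C_mul, inv_mul_cancel₀ he, C_1]
    set A : MvPolynomial (Fin 4) ℂ := C a * X 2 + C b * X 3
    set B : MvPolynomial (Fin 4) ℂ := C c * X 2 + C d * X 3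
    -- Modulo `h`, `e * X 3 ^ 2` is `-(X 0 * A + X 1 * B)`, whose square lies in the ideal of `X 0 ^
    -- 2`, `X 0 * X 1`, `X 1 ^ 2`. So `e ≠ 0` would make `X 3` nilpotent although its direction is
    -- tangent.
    have h2 : (X 3 ^ 4 : MvPolynomial (Fin 4) ℂ) = C e⁻¹ ^ 2 * ((h - 2 * (X 0 * A + X 1 * B)) * h +
        A ^ 2 * X 0 ^ 2 + 2 * A * B * (X 0 * X 1) + B ^ 2 * X 1 ^ 2) := by
      have h3 : C e * X 3 ^ 2 = h - (X 0 * A + X 1 * B) := by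
        rw [heq]
        simp
      have h4 : (X 3 ^ 2 : MvPolynomial (Fin 4) ℂ) = C e⁻¹ * (h - (X 0 * A + X 1 * B)) := by
        rw [← h3, ← mul_assoc, h1, one_mul]
      calc (X 3 ^ 4 : MvPolynomial (Fin 4) ℂ) = (X 3 ^ 2) ^ 2 := by ring
        _ = _ := by
          rw [h4]
          ring
    rw [h2]
    refine Ideal.mul_mem_left _ _ (add_mem (add_mem (add_mem ?_ ?_) ?_) ?_)
    · exact Ideal.mul_mem_left _ _ (Ideal.subset_span hh)
    · exact Ideal.mul_mem_left _ _ hI0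
    · exact Ideal.mul_mem_left _ _ hI01
    · exact Ideal.mul_mem_left _ _ hI1
  obtain rfl := hγ f _ _ _ _ _ hfV hf
  obtain rfl := hγ f' _ _ _ _ _ hfV' hf'
  -- The determinant of the two differentials in the normal directions is a binary quadratic form in
  -- the point `[0, 0, s, t]` of the line. At a zero of it some normal vector is tangent to the base
  -- scheme.
  obtain ⟨s, t, hst, hq⟩ := exists_quadratic_zero (a * c' - c * a')
    (a * d' + b * c' - c * b' - d * a') (b * d' - d * b')
  obtain ⟨w, hw, h⟩ := Matrix.exists_mulVec_eq_zero_iff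
    (M := !![a * s + b * t, c * s + d * t; a' * s + b' * t, c' * s + d' * t])
    |>.mpr (by rw [Matrix.det_fin_two_of]; linear_combination hq)
  have e0 := congrFun h 0
  have e1 := congrFun h 1
  simp [Matrix.mulVec, dotProduct, Fin.sum_univ_two] at e0 e1
  have hp' : ![0, 0, s, t] ≠ 0 := by
    intro h
    have h2 := congrFun h 2
    have h3 := congrFun h 3
    simp at h2 h3
    tauto
  have key : V ≤ vanishingAlong ![0, 0, s, t] ![w 0, w 1, 0, 0] := by
    apply hgen <;> rw [mem_vanishingAlong]
    · simp
    · simp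
    · simp
    · constructor
      · simp [hf]
      · simp [hf]
        linear_combination e0
    · constructor
      · simp [hf']
      · simp [hf']
        linear_combination e1
  have w0 := hV.coord_eq_zero hI0 hp' key
  have w1 := hV.coord_eq_zero hI1 hp' key
  simp only [Matrix.cons_val] at w0 w1
  exact hw (by ext i; fin_cases i <;> simp [w0, w1])

/-! ### Quadrics of rank three and four. -/

theorem exists_C_mul_of_dvd {k n : ℕ} {f g : MvPolynomial (Fin k) ℂ} (hf : f.IsHomogeneous n)
    (hg : g.IsHomogeneous n) (hg0 : g ≠ 0) (h : f ∣ g) : ∃ c, g = C c * f := by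
  obtain ⟨u, rfl⟩ := h
  obtain ⟨c, rfl⟩ := eq_C_of_isHomogeneous_zero
    (isHomogeneous_of_mul_left (m := n) (n := 0) hg hg0 hf)
  exact ⟨c, mul_comm _ _⟩

/-- Since `f₀` divides `f₁ f₂`, it splits as a divisor of `f₁` times a divisor of `f₂`. Neither
divisor is constant, because `f₁` and `f₂` are not multiples of `f₀`. -/
theorem exists_linear_factorization {k : ℕ} {f₀ f₁ f₂ f₃ : MvPolynomial (Fin k) ℂ}
    (h₀ : f₀.IsHomogeneous 2) (h₁ : f₁.IsHomogeneous 2) (h₂ : f₂.IsHomogeneous 2)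
    (h₀₀ : f₀ ≠ 0) (h₁₀ : ∀ c, f₁ ≠ C c * f₀) (h₂₀ : ∀ c, f₂ ≠ C c * f₀)
    (h : f₀ * f₃ = f₁ * f₂) : ∃ a b c d, f₀ = linForm a * linForm b ∧
      f₁ = linForm a * linForm c ∧ f₂ = linForm d * linForm b ∧ f₃ = linForm d * linForm c := by
  have h₁₁ : f₁ ≠ 0 := fun h => h₁₀ 0 (by simp [h])
  have h₂₂ : f₂ ≠ 0 := fun h => h₂₀ 0 (by simp [h])
  obtain ⟨a, b, ⟨c, rfl⟩, ⟨d, rfl⟩, rfl⟩ := exists_dvd_and_dvd_of_dvd_mul (Dvd.intro _ h)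
  have hf₃ : f₃ = d * c := mul_left_cancel₀ h₀₀ (by rw [h]; ring)
  obtain ⟨i, j, hij, ha, hb⟩ := isHomogeneous_of_mul h₀ h₀₀
  obtain ⟨i', j', hij', ha', hc⟩ := isHomogeneous_of_mul h₁ h₁₁
  obtain ⟨j'', i'', hij'', hb'', hd⟩ := isHomogeneous_of_mul h₂ h₂₂
  have ha0 := left_ne_zero_of_mul h₀₀
  have hb0 := right_ne_zero_of_mul h₀₀
  obtain rfl := ha.inj_right ha' ha0
  obtain rfl := hb.inj_right hb'' hb0
  rcases Nat.lt_or_ge i 1 with hi | hi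
  · obtain rfl : i = 0 := by omega
    obtain rfl : i'' = 0 := by omega
    obtain ⟨x, rfl⟩ := eq_C_of_isHomogeneous_zero ha
    obtain ⟨y, rfl⟩ := eq_C_of_isHomogeneous_zero hd
    have hx : x ≠ 0 := fun h => ha0 (by simp [h])
    refine absurd ?_ (h₂₀ (y / x))
    rw [← mul_assoc, ← C_mul, div_mul_cancel₀ _ hx, mul_comm]
  rcases Nat.lt_or_ge j 1 with hj | hj
  · obtain rfl : j = 0 := by omega
    obtain rfl : j' = 0 := by omega
    obtain ⟨x, rfl⟩ := eq_C_of_isHomogeneous_zero hb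
    obtain ⟨y, rfl⟩ := eq_C_of_isHomogeneous_zero hc
    have hx : x ≠ 0 := fun h => hb0 (by simp [h])
    refine absurd ?_ (h₁₀ (y / x))
    rw [mul_comm a (C x), ← mul_assoc, ← C_mul, div_mul_cancel₀ _ hx, mul_comm]
  obtain rfl : i = 1 := by omega
  obtain rfl : j = 1 := by omega
  obtain rfl : j' = 1 := by omega
  obtain rfl : i'' = 1 := by omega
  obtain ⟨a, rfl⟩ := exists_eq_linForm ha
  obtain ⟨b, rfl⟩ := exists_eq_linForm hb
  obtain ⟨c, rfl⟩ := exists_eq_linForm hc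
  obtain ⟨d, rfl⟩ := exists_eq_linForm hd
  exact ⟨a, b, c, d, rfl, rfl, mul_comm _ _, hf₃⟩

theorem ne_C_mul_of_linearIndependent {k j : ℕ} {f : Fin j → MvPolynomial (Fin k) ℂ}
    (hf : LinearIndependent ℂ f) {i i' : Fin j} (h : i ≠ i') (c : ℂ) : f i ≠ C c * f i' := by
  intro hc
  have h2 := Fintype.linearIndependent_iff.mp hf (Pi.single i 1 - Pi.single i' c) (by
    simp [sub_smul, Finset.sum_sub_distrib, Pi.single_apply, ite_smul, hc, smul_eq_C_mul]) i
  simp [h] at h2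

theorem linearIndependent_pair_of_mul {k : ℕ} {a d : Fin k → ℂ} {b : MvPolynomial (Fin k) ℂ}
    (h0 : linForm a * b ≠ 0) (h : ∀ c, linForm d * b ≠ C c * (linForm a * b)) :
    LinearIndependent ℂ ![a, d] := by
  rw [LinearIndependent.pair_iff]
  intro s t hst
  have ht : t = 0 := by
    by_contra ht
    apply h (-s / t)
    have : d = (-s / t) • a := by
      ext i
      have := congrFun hst i
      simp at this ⊢
      field_simp
      linear_combination this
    rw [this, map_smul, smul_eq_C_mul]
    ring
  subst ht
  refine ⟨?_, rfl⟩
  by_contra hs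
  have ha : a = 0 := by simpa [hs] using hst
  simp [ha] at h0

theorem linForm_mul_mem {V : Submodule ℂ (MvPolynomial (Fin 4) ℂ)} {a b c d : Fin 4 → ℂ}
    (hab : linForm a * linForm b ∈ V) (hac : linForm a * linForm c ∈ V)
    (hdb : linForm d * linForm b ∈ V) (hdc : linForm d * linForm c ∈ V) (s t s' t' : ℂ) :
    linForm (s • a + t • d) * linForm (s' • b + t' • c) ∈ V := by
  have : linForm (s • a + t • d) * linForm (s' • b + t' • c) =
      (s * s') • (linForm a * linForm b) + (s * t') • (linForm a * linForm c) +
      (t * s') • (linForm d * linForm b) + (t * t') • (linForm d * linForm c) := by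
    simp only [map_add, map_smul, smul_eq_C_mul, C_mul]
    ring
  rw [this]
  exact V.add_mem (V.add_mem (V.add_mem (V.smul_mem _ hab) (V.smul_mem _ hac))
    (V.smul_mem _ hdb)) (V.smul_mem _ hdc)

/-- The factorization has `f₁ = ac = db`; as `a` and `d` are independent, `b` and `c` are the same
multiple of `a` and `d`. Hence `V` contains `a²`, `ad`, `d²`. -/
theorem not_rank_three {V : Submodule ℂ (MvPolynomial (Fin 4) ℂ)} (hV : GoodSystem V)
    {f : Fin 3 → MvPolynomial (Fin 4) ℂ} (hfV : ∀ i, f i ∈ V) (hf : LinearIndependent ℂ f)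
    (h : f 0 * f 2 = f 1 * f 1) : False := by
  have hne := fun {i i' : Fin 3} (hi : i ≠ i') (c : ℂ) => ne_C_mul_of_linearIndependent hf hi c
  obtain ⟨a, b, c, d, h0, h1, h1', h2⟩ := exists_linear_factorization (hV.hom _ (hfV 0))
    (hV.hom _ (hfV 1)) (hV.hom _ (hfV 1)) (hf.ne_zero 0) (hne (by decide)) (hne (by decide)) h
  have had : LinearIndependent ℂ ![a, d] := by
    refine linearIndependent_pair_of_mul (b := linForm b) (h0 ▸ hf.ne_zero 0) fun c => ?_
    rw [← h1', ← h0]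
    exact hne (by decide) c
  have ha0 : a ≠ 0 := had.ne_zero 0
  have hb0 : linForm b ≠ 0 := right_ne_zero_of_mul (h0 ▸ hf.ne_zero 0)
  have hd0 : linForm d ≠ 0 := fun h => had.ne_zero 1 (linForm_eq_zero.mp h)
  have hb : ∃ k, linForm b = C k * linForm a := by
    have : linForm a ∣ linForm d * linForm b := ⟨linForm c, by rw [← h1', h1]⟩
    rcases (prime_linForm ha0).dvd_or_dvd this with hdv | hdv
    · exfalso
      obtain ⟨k, hk⟩ := exists_C_mul_of_dvd (linForm_isHomogeneous a) (linForm_isHomogeneous d)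
        hd0 hdv
      apply hne (show (1 : Fin 3) ≠ 0 by decide) k
      rw [h1', h0, hk]
      ring
    · exact exists_C_mul_of_dvd (linForm_isHomogeneous a) (linForm_isHomogeneous b) hb0 hdv
  obtain ⟨k, hk⟩ := hb
  have hk0 : k ≠ 0 := by
    rintro rfl
    simp [hk] at hb0
  have hc : linForm c = C k * linForm d := by
    refine mul_left_cancel₀ (fun h => ha0 (linForm_eq_zero.mp h)) (?_ : linForm a * _ = _)
    rw [← h1, h1', hk]
    ring
  have hscale : ∀ g : MvPolynomial (Fin 4) ℂ, C k * g ∈ V → g ∈ V := by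
    intro g hg
    have := C_mul_mem hg k⁻¹
    rwa [← mul_assoc, ← C_mul, inv_mul_cancel₀ hk0, C_1, one_mul] at this
  have haa : linForm a ^ 2 ∈ V := hscale _ (by
    have := hfV 0
    rw [h0, hk] at this
    convert this using 1
    ring)
  have hadV : linForm a * linForm d ∈ V := hscale _ (by
    have := hfV 1
    rw [h1, hc] at this
    convert this using 1
    ring)
  have hdd : linForm d ^ 2 ∈ V := hscale _ (by
    have := hfV 2
    rw [h2, hc] at this
    convert this using 1
    ring)
  obtain ⟨p, hp, hbase⟩ := hV.base
  have hpa : a ⬝ᵥ p = 0 := by simpa [eval_linForm] using hbase _ haa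
  have hpd : d ⬝ᵥ p = 0 := by simpa [eval_linForm] using hbase _ hdd
  obtain ⟨T, _, hT, hTv⟩ := exists_matrix_of_linearIndependent had
  have T0 : T 0 = a := hTv 0
  have T1 : T 1 = d := hTv 1
  have hTp : T.mulVec p ≠ 0 := by
    intro h0
    have := congrArg (T⁻¹.mulVec) h0
    rw [Matrix.mulVec_mulVec, Matrix.nonsing_inv_mul _ ((Matrix.isUnit_iff_isUnit_det T).mp hT),
      Matrix.one_mulVec, Matrix.mulVec_zero] at this
    exact hp this
  have hTp0 : T.mulVec p 0 = 0 := by rw [← hpa, ← T0]; rfl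
  have hTp1 : T.mulVec p 1 = 0 := by rw [← hpd, ← T1]; rfl
  set s := T.mulVec p 2 with hs
  set t := T.mulVec p 3 with ht
  -- A base point lies on `a = d = 0`; this change of the last two coordinates moves it to `[0, 0,
  -- 1, 0]`.
  obtain ⟨α, β, γ, δ, hdet, e1, e2⟩ : ∃ α β γ δ : ℂ, α * δ - β * γ ≠ 0 ∧
      α * s + β * t = 1 ∧ γ * s + δ * t = 0 := by
    by_cases hs0 : s = 0
    · have ht0 : t ≠ 0 := fun ht0 => hTp (by
        ext i
        fin_cases i
        · exact hTp0
        · exact hTp1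
        · exact hs0
        · exact ht0)
      exact ⟨0, t⁻¹, 1, 0, by simpa, by simp [ht0], by simp [hs0]⟩
    · exact ⟨s⁻¹, 0, -t, s, by simp [hs0], by simp [hs0], by ring⟩
  set M : Matrix (Fin 4) (Fin 4) ℂ := !![1, 0, 0, 0; 0, 1, 0, 0; 0, 0, α, β; 0, 0, γ, δ] with hM
  have hMu : IsUnit M := by
    rw [Matrix.isUnit_iff_isUnit_det, isUnit_iff_ne_zero]
    have : M.det = α * δ - β * γ := by
      simp [hM, Matrix.det_succ_row_zero, Fin.sum_univ_succ, Fin.succAbove]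
      ring
    rwa [this]
  have hU := hMu.mul hT
  have hU0 : (M * T) 0 = a := by
    rw [← T0]
    ext j
    simp [hM, Matrix.mul_apply, Fin.sum_univ_four]
  have hU1 : (M * T) 1 = d := by
    rw [← T1]
    ext j
    simp [hM, Matrix.mul_apply, Fin.sum_univ_four]
  have hUp : (M * T).mulVec p = ![0, 0, 1, 0] := by
    rw [← Matrix.mulVec_mulVec]
    ext i
    fin_cases i <;> simp [hM, Matrix.mulVec, dotProduct, Fin.sum_univ_four] <;>
      simp [Matrix.mulVec, dotProduct, Fin.sum_univ_four] at hTp0 hTp1 hs ht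
    · exact hTp0
    · exact hTp1
    · rw [← hs, ← ht]
      exact e1
    · rw [← hs, ← ht]
      exact e2
  have hUq : (M * T)⁻¹.mulVec ![0, 0, 1, 0] = p := by
    rw [← hUp, Matrix.mulVec_mulVec,
      Matrix.nonsing_inv_mul _ ((Matrix.isUnit_iff_isUnit_det _).mp hU), Matrix.one_mulVec]
  refine not_double_line (hV.subst (isUnit_inv hU)) ?_ ?_ ?_ ?_
  · exact mem_substSystem_inv hU (by rwa [map_pow, subst_X, hU0])
  · exact mem_substSystem_inv hU (by rwa [map_mul, subst_X, subst_X, hU0, hU1])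
  · exact mem_substSystem_inv hU (by rwa [map_pow, subst_X, hU1])
  · rintro _ ⟨g, hg, rfl⟩
    simpa [eval_subst, hUq] using hbase g hg

/-- The four products of the pencils `a, d` and `b, c` define the union of two lines. These are skew
or meet according to whether the four linear forms are independent. -/
theorem isConicType_or_isLineType_of_rank_four {V : Submodule ℂ (MvPolynomial (Fin 4) ℂ)}
    (hV : GoodSystem V) {f : Fin 4 → MvPolynomial (Fin 4) ℂ} (hfV : ∀ i, f i ∈ V)
    (hf : LinearIndependent ℂ f) (h : f 0 * f 3 = f 1 * f 2) :
    IsConicType V ∨ IsLineType V := by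
  have hne := fun {i i' : Fin 4} (hi : i ≠ i') (c : ℂ) => ne_C_mul_of_linearIndependent hf hi c
  obtain ⟨a, b, c, d, h0, h1, h2, h3⟩ := exists_linear_factorization (hV.hom _ (hfV 0))
    (hV.hom _ (hfV 1)) (hV.hom _ (hfV 2)) (hf.ne_zero 0) (hne (by decide)) (hne (by decide)) h
  have had : LinearIndependent ℂ ![a, d] := by
    refine linearIndependent_pair_of_mul (b := linForm b) (h0 ▸ hf.ne_zero 0) fun c => ?_
    rw [← h2, ← h0]
    exact hne (by decide) c
  have hbc : LinearIndependent ℂ ![b, c] := by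
    refine linearIndependent_pair_of_mul (b := linForm a)
      (by rw [mul_comm, ← h0]; exact hf.ne_zero 0) fun k => ?_
    rw [mul_comm, ← h1, mul_comm (linForm b), ← h0]
    exact hne (by decide) k
  have hab : linForm a * linForm b ∈ V := h0 ▸ hfV 0
  have hac : linForm a * linForm c ∈ V := h1 ▸ hfV 1
  have hdb : linForm d * linForm b ∈ V := h2 ▸ hfV 2
  have hdc : linForm d * linForm c ∈ V := h3 ▸ hfV 3
  by_cases hind : LinearIndependent ℂ ![a, d, b, c]
  · right
    obtain ⟨T, _, hT, hTv⟩ := exists_matrix_of_linearIndependent hind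
    have T0 : T 0 = a := hTv 0
    have T1 : T 1 = d := hTv 1
    have T2 : T 2 = b := hTv 2
    have T3 : T 3 = c := hTv 3
    refine IsLineType.of_subst (isUnit_inv hT) (isLineType_of_skew (hV.subst (isUnit_inv hT))
      ?_ ?_ ?_ ?_) <;> apply mem_substSystem_inv hT <;>
      simpa only [map_mul, subst_X, T0, T1, T2, T3]
  · left
    rw [LinearIndependent.pair_iff] at had hbc
    -- A dependence gives a nonzero form common to both pencils, the future `X 0`; `d'` completes it
    -- to a basis of the first pencil, and `c'` is taken in the second pencil outside the first.
    obtain ⟨α, δ, β, γ, hrel, hαδ⟩ : ∃ α δ β γ : ℂ, α • a + δ • d = β • b + γ • c ∧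
        (α ≠ 0 ∨ δ ≠ 0) := by
      rw [Fintype.linearIndependent_iff] at hind
      push Not at hind
      obtain ⟨g, hg, i, hi⟩ := hind
      simp [Fin.sum_univ_four] at hg
      refine ⟨g 0, g 1, -g 2, -g 3, ?_, ?_⟩
      · rw [← sub_eq_zero, ← hg]
        module
      · by_contra! h01
        obtain ⟨e2, e3⟩ := hbc (g 2) (g 3) (by simpa [h01] using hg)
        fin_cases i
        · exact hi h01.1
        · exact hi h01.2
        · exact hi e2
        · exact hi e3
    obtain ⟨c', hc', s', t', hc's⟩ : ∃ c', (∀ x y : ℂ, c' ≠ x • a + y • d) ∧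
        ∃ s t : ℂ, c' = s • b + t • c := by
      by_contra! hcon
      have hb : ∃ x y : ℂ, b = x • a + y • d := by
        by_contra! hb
        exact hcon b hb 1 0 (by simp)
      have hc : ∃ x y : ℂ, c = x • a + y • d := by
        by_contra! hc
        exact hcon c hc 0 1 (by simp)
      obtain ⟨x, y, hb⟩ := hb
      obtain ⟨z, w, hc⟩ := hc
      -- If both pencils were equal, the four products would be binary quadratic forms in `a, d`, of
      -- which only three are independent.
      have := Fintype.linearIndependent_iff.mp hf ![z, -x, w, -y] (by
        simp [Fin.sum_univ_four, h0, h1, h2, h3, hb, hc, smul_eq_C_mul]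
        ring)
      have hx := this 1
      have hy := this 3
      simp at hx hy
      apply hf.ne_zero 0
      rw [h0, hb]
      simp [hx, hy]
    obtain ⟨d', s, t, hd', hlin⟩ : ∃ d', ∃ s t : ℂ, d' = s • a + t • d ∧
        ∀ x y : ℂ, x • (α • a + δ • d) + y • d' = 0 → x = 0 ∧ y = 0 := by
      by_cases hα : α = 0
      · refine ⟨a, 1, 0, by simp, fun x y hxy => ?_⟩
        have hδ : δ ≠ 0 := by simpa [hα] using hαδ
        obtain ⟨k1, k2⟩ := had (x * α + y) (x * δ) (by rw [← hxy]; module)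
        have hx : x = 0 := by simpa [hδ] using k2
        exact ⟨hx, by simpa [hx] using k1⟩
      · refine ⟨d, 0, 1, by simp, fun x y hxy => ?_⟩
        obtain ⟨k1, k2⟩ := had (x * α) (x * δ + y) (by rw [← hxy]; module)
        have hx : x = 0 := by simpa [hα] using k1
        exact ⟨hx, by simpa [hx] using k2⟩
    have hind3 : LinearIndependent ℂ ![α • a + δ • d, d', c'] := by
      rw [Fintype.linearIndependent_iff]
      intro g hg
      simp only [Fin.sum_univ_three, Matrix.cons_val] at hg
      have hg2 : g 2 = 0 := by
        by_contra hg2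
        apply hc' (-(g 0 * α + g 1 * s) / g 2) (-(g 0 * δ + g 1 * t) / g 2)
        have : g 2 • c' = (-(g 0 * α + g 1 * s)) • a + (-(g 0 * δ + g 1 * t)) • d := by
          rw [← sub_eq_zero, ← hg, hd']
          module
        rw [← inv_smul_smul₀ hg2 c', this]
        module
      obtain ⟨k0, k1⟩ := hlin (g 0) (g 1) (by simpa [hg2] using hg)
      intro i
      fin_cases i <;> simpa
    obtain ⟨T, _, hT, hTv⟩ := exists_matrix_of_linearIndependent hind3
    have T0 : T 0 = α • a + δ • d := hTv 0
    have T1 : T 1 = d' := hTv 1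
    have T2 : T 2 = c' := hTv 2
    have key := linForm_mul_mem hab hac hdb hdc
    refine IsConicType.of_subst (isUnit_inv hT) (isConicType_of_meeting
      (hV.subst (isUnit_inv hT)) ?_ ?_ ?_ ?_) <;> apply mem_substSystem_inv hT <;>
      simp only [map_mul, map_pow, subst_X, T0, T1, T2]
    · have := key α δ β γ
      rwa [← hrel, ← pow_two] at this
    · have := key s t β γ
      rwa [← hrel, ← hd', mul_comm] at this
    · have := key α δ s' t'
      rwa [← hc's] at this
    · have := key s t s' t'
      rwa [← hd', ← hc's] at this

/-! ### Isotropic subspaces for the dot product. -/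

theorem exists_dotProduct_eq {r n : ℕ} {w : Fin r → Fin n → ℂ} (hw : LinearIndependent ℂ w)
    (c : Fin r → ℂ) : ∃ u : Fin n → ℂ, ∀ k, w k ⬝ᵥ u = c k := by
  have hrank : (Matrix.of w).rank = r := by
    have := LinearIndependent.rank_matrix (M := Matrix.of w) hw
    simpa using this
  have htop : LinearMap.range (Matrix.of w).mulVecLin = ⊤ :=
    Submodule.eq_top_of_finrank_eq (hrank.trans (by simp))
  obtain ⟨u, hu⟩ := LinearMap.range_eq_top.mp htop c
  exact ⟨u, fun k => congrFun hu k⟩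

theorem exists_eq_combination {n : ℕ} {a b c : Fin n → ℂ}
    (h : ∀ z, a ⬝ᵥ z = 0 → b ⬝ᵥ z = 0 → c ⬝ᵥ z = 0) : ∃ x y : ℂ, c = x • a + y • b := by
  have h1 := mem_span_of_iInf_ker_le_ker (𝕜 := ℂ)
    (L := ![dotProductBilin ℂ ℂ a, dotProductBilin ℂ ℂ b])
    (K := dotProductBilin ℂ ℂ c) (fun z hz => by
      simp only [Submodule.mem_iInf, LinearMap.mem_ker] at hz ⊢
      exact h z (hz 0) (hz 1))
  rw [Submodule.mem_span_range_iff_exists_fun] at h1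
  obtain ⟨g, hg⟩ := h1
  refine ⟨g 0, g 1, ?_⟩
  ext i
  have := DFunLike.congr_fun hg (Pi.single i 1)
  simpa [Fin.sum_univ_two] using this.symm

/-- The matrix `W` with rows `w i` satisfies `W Wᵀ = 0`, so twice its rank is at most `n`. -/
theorem rank_le_of_isotropic {r n : ℕ} {w : Fin r → Fin n → ℂ} (hw : LinearIndependent ℂ w)
    (h : ∀ i j, w i ⬝ᵥ w j = 0) : r + r ≤ n := by
  have hrank : (Matrix.of w).rank = r := by
    have := LinearIndependent.rank_matrix (M := Matrix.of w) hw
    simpa using this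
  have h0 : Matrix.of w * (Matrix.of w).transpose = 0 := by
    ext i j
    simpa [Matrix.mul_apply, dotProduct] using h i j
  have := Matrix.rank_add_rank_le_card_of_mul_eq_zero h0
  rw [Matrix.rank_transpose, hrank] at this
  simpa using this

/-- An isotropic plane in dimension five is completed to two hyperbolic pairs and a unit vector. The
last identity rewrites the sum of squares as `2 y₀ y₂ + 2 y₁ y₃ + y₄²`. -/
theorem exists_witt_basis {w₀ w₁ : Fin 5 → ℂ} (hw : LinearIndependent ℂ ![w₀, w₁])
    (h00 : w₀ ⬝ᵥ w₀ = 0) (h01 : w₀ ⬝ᵥ w₁ = 0) (h11 : w₁ ⬝ᵥ w₁ = 0) :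
    ∃ P : Matrix (Fin 5) (Fin 5) ℂ, IsUnit P ∧ P 0 = w₀ ∧ P 1 = w₁ ∧ P.transpose *
      !![0, 0, 1, 0, 0; 0, 0, 0, 1, 0; 1, 0, 0, 0, 0; 0, 1, 0, 0, 0; 0, 0, 0, 0, 1] * P = 1 := by
  obtain ⟨u₂, hu₂⟩ := exists_dotProduct_eq hw ![1, 0]
  obtain ⟨u₃, hu₃⟩ := exists_dotProduct_eq hw ![0, 1]
  have a02 : w₀ ⬝ᵥ u₂ = 1 := hu₂ 0
  have a12 : w₁ ⬝ᵥ u₂ = 0 := hu₂ 1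
  have a03 : w₀ ⬝ᵥ u₃ = 0 := hu₃ 0
  have a13 : w₁ ⬝ᵥ u₃ = 1 := hu₃ 1
  have h10 : w₁ ⬝ᵥ w₀ = 0 := by rw [dotProduct_comm, h01]
  have a20 : u₂ ⬝ᵥ w₀ = 1 := by rw [dotProduct_comm, a02]
  have a21 : u₂ ⬝ᵥ w₁ = 0 := by rw [dotProduct_comm, a12]
  have a30 : u₃ ⬝ᵥ w₀ = 0 := by rw [dotProduct_comm, a03]
  have a31 : u₃ ⬝ᵥ w₁ = 1 := by rw [dotProduct_comm, a13]
  obtain ⟨w₂, w₃, b02, b12, b03, b13, b22, b23, b33⟩ : ∃ w₂ w₃ : Fin 5 → ℂ, w₀ ⬝ᵥ w₂ = 1 ∧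
      w₁ ⬝ᵥ w₂ = 0 ∧ w₀ ⬝ᵥ w₃ = 0 ∧ w₁ ⬝ᵥ w₃ = 1 ∧ w₂ ⬝ᵥ w₂ = 0 ∧ w₂ ⬝ᵥ w₃ = 0 ∧
      w₃ ⬝ᵥ w₃ = 0 := by
    -- Subtracting multiples of `w₀`, `w₁` keeps the pairings with the isotropic plane and removes
    -- those among `u₂`, `u₃`.
    refine ⟨u₂ - (u₂ ⬝ᵥ u₂ / 2) • w₀, u₃ - (u₂ ⬝ᵥ u₃) • w₀ - (u₃ ⬝ᵥ u₃ / 2) • w₁,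
      ?_, ?_, ?_, ?_, ?_, ?_, ?_⟩ <;>
    simp only [dotProduct_sub, sub_dotProduct, dotProduct_smul, smul_dotProduct, smul_eq_mul,
      h00, h01, h10, h11, a02, a12, a03, a13, a20, a21, a30, a31] <;> ring
  have b20 : w₂ ⬝ᵥ w₀ = 1 := by rw [dotProduct_comm, b02]
  have b21 : w₂ ⬝ᵥ w₁ = 0 := by rw [dotProduct_comm, b12]
  have b30 : w₃ ⬝ᵥ w₀ = 0 := by rw [dotProduct_comm, b03]
  have b31 : w₃ ⬝ᵥ w₁ = 1 := by rw [dotProduct_comm, b13]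
  have b32 : w₃ ⬝ᵥ w₂ = 0 := by rw [dotProduct_comm, b23]
  obtain ⟨n, hn, hn0⟩ := Matrix.exists_mulVec_eq_zero_iff (M := Matrix.of ![w₀, w₁, w₂, w₃, 0])
    |>.mpr (Matrix.det_eq_zero_of_row_eq_zero 4 (fun j => rfl))
  have n0 : w₀ ⬝ᵥ n = 0 := congrFun hn0 0
  have n1 : w₁ ⬝ᵥ n = 0 := congrFun hn0 1
  have n2 : w₂ ⬝ᵥ n = 0 := congrFun hn0 2
  have n3 : w₃ ⬝ᵥ n = 0 := congrFun hn0 3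
  -- Otherwise `w₀, w₁, n` would span an isotropic space of dimension three in dimension five.
  have hnn : n ⬝ᵥ n ≠ 0 := by
    intro hnn
    have hli : LinearIndependent ℂ ![w₀, w₁, n] := by
      rw [Fintype.linearIndependent_iff]
      intro g hg
      simp only [Fin.sum_univ_three, Matrix.cons_val] at hg
      have k0 : g 0 = 0 := by
        have := congrArg (w₂ ⬝ᵥ ·) hg
        simpa [dotProduct_add, dotProduct_smul, b20, b21, n2] using this
      have k1 : g 1 = 0 := by
        have := congrArg (w₃ ⬝ᵥ ·) hg
        simpa [dotProduct_add, dotProduct_smul, b30, b31, n3] using this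
      have k2 : g 2 = 0 := by simpa [k0, k1, hn] using hg
      intro i
      fin_cases i <;> assumption
    have := rank_le_of_isotropic hli (fun i j => by
      have n0' := n0
      have n1' := n1
      rw [dotProduct_comm] at n0' n1'
      fin_cases i <;> fin_cases j <;> assumption)
    omega
  obtain ⟨r, hr⟩ := IsAlgClosed.exists_pow_nat_eq (n ⬝ᵥ n) (n := 2) (by norm_num)
  have hr0 : r ≠ 0 := by
    rintro rfl
    simp at hr
    exact hnn hr.symm
  obtain ⟨w₄, b04, b14, b24, b34, b44⟩ : ∃ w₄ : Fin 5 → ℂ, w₀ ⬝ᵥ w₄ = 0 ∧ w₁ ⬝ᵥ w₄ = 0 ∧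
      w₂ ⬝ᵥ w₄ = 0 ∧ w₃ ⬝ᵥ w₄ = 0 ∧ w₄ ⬝ᵥ w₄ = 1 := by
    refine ⟨r⁻¹ • n, ?_, ?_, ?_, ?_, ?_⟩ <;>
      simp only [dotProduct_smul, smul_dotProduct, n0, n1, n2, n3, mul_zero, ← hr, smul_eq_mul]
    field_simp
  have b40 : w₄ ⬝ᵥ w₀ = 0 := by rw [dotProduct_comm, b04]
  have b41 : w₄ ⬝ᵥ w₁ = 0 := by rw [dotProduct_comm, b14]
  have b42 : w₄ ⬝ᵥ w₂ = 0 := by rw [dotProduct_comm, b24]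
  have b43 : w₄ ⬝ᵥ w₃ = 0 := by rw [dotProduct_comm, b34]
  set J : Matrix (Fin 5) (Fin 5) ℂ :=
    !![0, 0, 1, 0, 0; 0, 0, 0, 1, 0; 1, 0, 0, 0, 0; 0, 1, 0, 0, 0; 0, 0, 0, 0, 1] with hJ
  have hPP : Matrix.of ![w₀, w₁, w₂, w₃, w₄] * (Matrix.of ![w₀, w₁, w₂, w₃, w₄]).transpose = J := by
    ext i j
    change ![w₀, w₁, w₂, w₃, w₄] i ⬝ᵥ ![w₀, w₁, w₂, w₃, w₄] j = J i j
    fin_cases i <;> fin_cases j <;> assumption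
  have hJJ : J * J = 1 := by
    ext i j
    fin_cases i <;> fin_cases j <;> simp [hJ, Matrix.mul_apply, Fin.sum_univ_five]
  have h1 : Matrix.of ![w₀, w₁, w₂, w₃, w₄] *
      ((Matrix.of ![w₀, w₁, w₂, w₃, w₄]).transpose * J) = 1 := by
    rw [← Matrix.mul_assoc, hPP, hJJ]
  exact ⟨Matrix.of ![w₀, w₁, w₂, w₃, w₄], IsUnit.of_mul_eq_one _ h1, rfl, rfl,
    mul_eq_one_comm.mp h1⟩

/-- The `w k` are a basis of the column space and the `l k` the coordinate functions of the map.
That each `w k` is a value makes isotropy of all values pass to them. -/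
theorem exists_rank_factorization {m n : ℕ} (M : Matrix (Fin m) (Fin n) ℂ) :
    ∃ (r : ℕ) (w : Fin r → Fin m → ℂ) (l : Fin r → Fin n → ℂ), LinearIndependent ℂ w ∧
      LinearIndependent ℂ l ∧ (∀ k, ∃ x, M.mulVec x = w k) ∧
      ∀ i j, M i j = ∑ k, w k i * l k j := by
  obtain ⟨r, b⟩ : ∃ r : ℕ, Nonempty (Module.Basis (Fin r) ℂ (LinearMap.range M.mulVecLin)) :=
    ⟨_, ⟨Module.finBasis ℂ _⟩⟩
  obtain ⟨b⟩ := b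
  have hx : ∀ k, ∃ x, M.mulVec x = b k := fun k => (b k).2
  choose x hx using hx
  obtain ⟨φ, hφ⟩ : ∃ φ : Fin r → (Fin n → ℂ) →ₗ[ℂ] ℂ,
      ∀ k y, φ k y = b.repr (M.mulVecLin.rangeRestrict y) k :=
    ⟨fun k => b.coord k ∘ₗ M.mulVecLin.rangeRestrict, fun k y => rfl⟩
  have hφx : ∀ k k', φ k' (x k) = if k = k' then 1 else 0 := by
    intro k k'
    have h2 : M.mulVecLin.rangeRestrict (x k) = b k := Subtype.ext (hx k)
    rw [hφ, h2, b.repr_self, Finsupp.single_apply]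
  have hl : ∀ y k, (fun j => φ k (Pi.single j 1)) ⬝ᵥ y = φ k y := by
    intro y k
    conv_rhs => rw [← Finset.univ_sum_single y]
    rw [map_sum, dotProduct]
    refine Finset.sum_congr rfl fun j _ => ?_
    rw [mul_comm, ← smul_eq_mul, ← map_smul, ← Pi.single_smul, smul_eq_mul, mul_one]
  have hb := b.linearIndependent.map' (LinearMap.range M.mulVecLin).subtype
    (Submodule.ker_subtype _)
  refine ⟨r, (LinearMap.range M.mulVecLin).subtype ∘ b, fun k j => φ k (Pi.single j 1), hb, ?_, fun k => ⟨x k, hx k⟩, fun i j => ?_⟩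
  · rw [Fintype.linearIndependent_iff]
    intro g hg k
    have h1 := congrArg (· ⬝ᵥ x k) hg
    rw [zero_dotProduct, sum_dotProduct, Finset.sum_eq_single k] at h1
    · rwa [smul_dotProduct, hl, hφx, if_pos rfl, smul_eq_mul, mul_one] at h1
    · intro k' _ hk'
      rw [smul_dotProduct, hl, hφx, if_neg hk'.symm, smul_zero]
    · exact fun h => absurd (Finset.mem_univ k) h
  · have h1 := congrArg Subtype.val (b.sum_repr (M.mulVecLin.rangeRestrict (Pi.single j 1)))
    have h2 := congrFun h1 i
    have h3 : (M.mulVecLin.rangeRestrict (Pi.single j 1) : Fin m → ℂ) i = M i j := by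
      simp
    rw [h3, Submodule.coe_sum, Finset.sum_apply] at h2
    rw [← h2]
    refine Finset.sum_congr rfl fun k _ => ?_
    rw [← hφ]
    exact mul_comm _ _

/-! ### Quadrics of rank five. -/

/-- A quadratic form along a line. -/
theorem exists_polar {f : MvPolynomial (Fin 4) ℂ} (hf : f.IsHomogeneous 2) (p : Fin 4 → ℂ) :
    ∃ v : Fin 4 → ℂ, ∀ (x : Fin 4 → ℂ) (t : ℂ),
      eval (x + t • p) f = eval x f + t * (v ⬝ᵥ x) + t ^ 2 * eval p f := by
  obtain ⟨c, rfl⟩ := exists_quadric_coeffs hf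
  refine ⟨![2 * c 0 * p 0 + c 1 * p 1 + c 2 * p 2 + c 3 * p 3,
    c 1 * p 0 + 2 * c 4 * p 1 + c 5 * p 2 + c 6 * p 3,
    c 2 * p 0 + c 5 * p 1 + 2 * c 7 * p 2 + c 8 * p 3,
    c 3 * p 0 + c 6 * p 1 + c 8 * p 2 + 2 * c 9 * p 3], fun x t => ?_⟩
  simp [dotProduct, Fin.sum_univ_four]
  ring

/-- The syzygy gives `F 0 = bμ` and `F 1 = -aμ`. By the quadratic relation `μ` divides `F 4 ^ 2`,
hence `F 4 = μν`. Cancelling `μ` yields a relation that forces `μ` into the pencil of `a, b` and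
gives a combination of `F 2`, `F 3` divisible by `μ`. These four multiples of `μ` are independent,
so they exhaust all its products with linear forms. -/
theorem isConicType_of_syzygy {V : Submodule ℂ (MvPolynomial (Fin 4) ℂ)} {a b : Fin 4 → ℂ}
    (hab : LinearIndependent ℂ ![a, b]) {F : Fin 5 → MvPolynomial (Fin 4) ℂ}
    (hF : LinearIndependent ℂ F) (hFV : ∀ i, F i ∈ V) (hom : ∀ i, (F i).IsHomogeneous 2)
    (hsyz : linForm a * F 0 + linForm b * F 1 = 0)
    (hq : 2 * F 0 * F 2 + 2 * F 1 * F 3 + F 4 ^ 2 = 0) : IsConicType V := by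
  have hli := Fintype.linearIndependent_iff.mp hF
  have ha0 : a ≠ 0 := hab.ne_zero 0
  have hb0 : b ≠ 0 := hab.ne_zero 1
  have hab' := LinearIndependent.pair_iff.mp hab
  have hla0 : linForm a ≠ 0 := fun h => ha0 (linForm_eq_zero.mp h)
  have hlb0 : linForm b ≠ 0 := fun h => hb0 (linForm_eq_zero.mp h)
  obtain ⟨μ, h1, h0⟩ : ∃ μ, F 1 = -(linForm a * linForm μ) ∧ F 0 = linForm b * linForm μ := by
    have hdvd : linForm a ∣ linForm b * F 1 := ⟨-F 0, by linear_combination hsyz⟩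
    rcases (prime_linForm ha0).dvd_or_dvd hdvd with h | ⟨m, hm⟩
    · exfalso
      obtain ⟨c, hc⟩ := exists_C_mul_of_dvd (linForm_isHomogeneous a) (linForm_isHomogeneous b)
        hlb0 h
      have : b = c • a := linForm_injective (by rw [hc, map_smul, smul_eq_C_mul])
      have := (hab' c (-1) (by rw [this]; module)).2
      norm_num at this
    · have hhom : m.IsHomogeneous 1 := by
        have h1 := hom 1
        rw [hm] at h1
        exact isHomogeneous_of_mul_left (m := 1) (n := 1) h1 (hm ▸ hF.ne_zero 1)
          (linForm_isHomogeneous a)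
      obtain ⟨ν, rfl⟩ := exists_eq_linForm hhom
      refine ⟨-ν, by rw [hm, map_neg]; ring, ?_⟩
      refine mul_left_cancel₀ hla0 ?_
      rw [hm] at hsyz
      rw [map_neg]
      linear_combination hsyz
  have hμ0 : μ ≠ 0 := fun h => hF.ne_zero 0 (by rw [h0, h]; simp)
  have hm0 : linForm μ ≠ 0 := fun h => hμ0 (linForm_eq_zero.mp h)
  have hmp := prime_linForm hμ0
  obtain ⟨ν, h4⟩ : ∃ ν, F 4 = linForm μ * linForm ν := by
    have hdvd : linForm μ ∣ F 4 ^ 2 :=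
      ⟨2 * (linForm a * F 3 - linForm b * F 2), by rw [h0, h1] at hq; linear_combination hq⟩
    obtain ⟨n, hn⟩ := hmp.dvd_of_dvd_pow hdvd
    have hhom : n.IsHomogeneous 1 := by
      have h1 := hom 4
      rw [hn] at h1
      exact isHomogeneous_of_mul_left (m := 1) (n := 1) h1 (hn ▸ hF.ne_zero 4)
        (linForm_isHomogeneous μ)
    obtain ⟨ν, rfl⟩ := exists_eq_linForm hhom
    exact ⟨ν, hn⟩
  have hrel : linForm μ * linForm ν ^ 2 = 2 * (linForm a * F 3 - linForm b * F 2) := by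
    refine mul_left_cancel₀ hm0 ?_
    rw [h0, h1, h4] at hq
    linear_combination hq
  -- If `ν` were a combination of `a` and `b`, then `F 4` would be one of `F 0` and `F 1`.
  obtain ⟨z₁, hz₁a, hz₁b, hz₁⟩ : ∃ z, a ⬝ᵥ z = 0 ∧ b ⬝ᵥ z = 0 ∧ ν ⬝ᵥ z ≠ 0 := by
    by_contra! hcon
    obtain ⟨x, y, hxy⟩ := exists_eq_combination hcon
    have := hli ![-y, x, 0, 0, 1] (by
      simp only [Fin.sum_univ_five, Matrix.cons_val, h0, h1, h4, hxy, map_add, map_smul,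
        smul_eq_C_mul, C_neg, C_0, C_1]
      ring) 4
    simp at this
  have hvan : ∀ z, a ⬝ᵥ z = 0 → b ⬝ᵥ z = 0 → ν ⬝ᵥ z ≠ 0 → μ ⬝ᵥ z = 0 := by
    intro z hza hzb hzν
    have := congrArg (eval z) hrel
    simpa [eval_linForm, hza, hzb, hzν] using this
  -- On `a = b = 0` the product `μν²` vanishes, so `μ` vanishes wherever `ν` does not; translating
  -- by `z₁` reaches the zeros of `ν`.
  obtain ⟨x, y, hxy⟩ : ∃ x y : ℂ, μ = x • a + y • b := by
    apply exists_eq_combination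
    intro z hza hzb
    by_cases hz : ν ⬝ᵥ z = 0
    · have h2 := hvan (z + z₁) (by simp [hza, hz₁a]) (by simp [hzb, hz₁b])
        (by simpa [hz] using hz₁)
      simpa [hvan z₁ hz₁a hz₁b hz₁] using h2
    · exact hvan z hza hzb hz
  have hmxy : linForm μ = C x * linForm a + C y * linForm b := by
    rw [hxy, map_add, map_smul, map_smul, smul_eq_C_mul, smul_eq_C_mul]
  set f := C x * F 2 + C y * F 3 with hf
  have hC2 : (2 : MvPolynomial (Fin 4) ℂ) * C (1 / 2) = 1 := by
    have : (2 : MvPolynomial (Fin 4) ℂ) = C 2 := (map_ofNat C 2).symm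
    rw [this, ← C_mul]
    norm_num
  -- Modulo `μ`, `a F₃ = b F₂` and `xa + yb = 0`. Hence `μ` divides both `af` and `bf`, but not both
  -- of `a`, `b`, so it divides `f`.
  have hda : linForm μ ∣ linForm a * f :=
    ⟨F 2 + C (1 / 2) * C y * linForm ν ^ 2, by
      rw [hf]
      linear_combination -F 2 * hmxy - C (1 / 2) * C y * hrel +
        (- C y * (linForm a * F 3 - linForm b * F 2)) * hC2⟩
  have hdb : linForm μ ∣ linForm b * f :=
    ⟨F 3 - C (1 / 2) * C x * linForm ν ^ 2, by
      rw [hf]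
      linear_combination -F 3 * hmxy + C (1 / 2) * C x * hrel +
        (C x * (linForm a * F 3 - linForm b * F 2)) * hC2⟩
  have hfhom : f.IsHomogeneous 2 := ((hom 2).C_mul x).add ((hom 3).C_mul y)
  have hf0 : f ≠ 0 := by
    intro h
    have := hli ![0, 0, x, y, 0] (by
      simp only [Fin.sum_univ_five, Matrix.cons_val, smul_eq_C_mul, C_0]
      linear_combination h)
    have hx := this 2
    have hy := this 3
    simp at hx hy
    exact hμ0 (by simp [hxy, hx, hy])
  have hdf : linForm μ ∣ f := by
    rcases hmp.dvd_or_dvd hda with h | h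
    · rcases hmp.dvd_or_dvd hdb with h' | h'
      · exfalso
        obtain ⟨c, hc⟩ := exists_C_mul_of_dvd (linForm_isHomogeneous μ) (linForm_isHomogeneous a)
          hla0 h
        obtain ⟨c', hc'⟩ := exists_C_mul_of_dvd (linForm_isHomogeneous μ)
          (linForm_isHomogeneous b) hlb0 h'
        have ea : a = c • μ := linForm_injective (by rw [hc, map_smul, smul_eq_C_mul])
        have eb : b = c' • μ := linForm_injective (by rw [hc', map_smul, smul_eq_C_mul])
        have := hab' c' (-c) (by rw [ea, eb]; module)
        exact ha0 (by rw [ea, neg_eq_zero.mp this.2, zero_smul])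
      · exact h'
    · exact h
  obtain ⟨κ, hκ⟩ : ∃ κ, f = linForm μ * linForm κ := by
    obtain ⟨n, hn⟩ := hdf
    have hhom : n.IsHomogeneous 1 := by
      rw [hn] at hfhom
      exact isHomogeneous_of_mul_left (m := 1) (n := 1) hfhom (hn ▸ hf0) (linForm_isHomogeneous μ)
    obtain ⟨κ, rfl⟩ := exists_eq_linForm hhom
    exact ⟨κ, hn⟩
  have hbasis : LinearIndependent ℂ ![a, b, ν, κ] := by
    rw [Fintype.linearIndependent_iff]
    intro g hg
    simp only [Fin.sum_univ_four, Matrix.cons_val] at hg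
    have h5 := congrArg (fun u => linForm μ * linForm u) hg
    simp only [map_add, map_smul, map_zero, mul_zero, smul_eq_C_mul] at h5
    have := hli ![g 1, -g 0, g 3 * x, g 3 * y, g 2] (by
      simp only [Fin.sum_univ_five, Matrix.cons_val, smul_eq_C_mul, C_neg, C_mul]
      rw [h4, h0, h1]
      rw [hf] at hκ
      linear_combination h5 + C (g 3) * hκ)
    have k0 := this 0
    have k1 := this 1
    have k2 := this 2
    have k3 := this 3
    have k4 := this 4
    simp only [Matrix.cons_val, neg_eq_zero, mul_eq_zero] at k0 k1 k2 k3 k4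
    have k5 : g 3 = 0 := by
      by_contra h
      exact hμ0 (by simp [hxy, k2.resolve_left h, k3.resolve_left h])
    intro i
    fin_cases i <;> assumption
  have htop := hbasis.span_eq_top_of_card_eq_finrank' (by simp)
  refine ⟨linForm μ, hm0, fun i => ?_⟩
  let W : Submodule ℂ (Fin 4 → ℂ) :=
    V.comap ((LinearMap.mulLeft ℂ (linForm μ)).comp linForm)
  have hW : W = ⊤ := by
    rw [← top_le_iff, ← htop, Submodule.span_le]
    rintro _ ⟨j, rfl⟩
    change linForm μ * linForm _ ∈ V
    fin_cases j
    · have := V.neg_mem (hFV 1)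
      rw [h1, neg_neg, mul_comm] at this
      exact this
    · have := hFV 0
      rw [h0, mul_comm] at this
      exact this
    · exact h4 ▸ hFV 4
    · exact hκ ▸ V.add_mem (C_mul_mem (hFV 2) x) (C_mul_mem (hFV 3) y)
  have : Pi.single i 1 ∈ W := hW ▸ Submodule.mem_top
  rw [← linForm_single]
  exact this

/-- The combinations of the `F i` with coefficients the rows of `P`. -/
noncomputable def combine {k n : ℕ} (P : Matrix (Fin n) (Fin n) ℂ)
    (F : Fin n → MvPolynomial (Fin k) ℂ) (i : Fin n) : MvPolynomial (Fin k) ℂ :=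
  ∑ j, P i j • F j

theorem eval_combine {k n : ℕ} (P : Matrix (Fin n) (Fin n) ℂ) (F : Fin n → MvPolynomial (Fin k) ℂ)
    (i : Fin n) (x : Fin k → ℂ) :
    eval x (combine P F i) = P.mulVec (fun j => eval x (F j)) i := by
  simp [combine, Matrix.mulVec, dotProduct, smul_eval]

theorem linearIndependent_combine {k n : ℕ} {P : Matrix (Fin n) (Fin n) ℂ} (hP : IsUnit P)
    {F : Fin n → MvPolynomial (Fin k) ℂ} (hF : LinearIndependent ℂ F) :
    LinearIndependent ℂ (combine P F) := by
  rw [Fintype.linearIndependent_iff]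
  intro g hg
  have h1 : Matrix.vecMul g P = 0 := by
    ext j
    refine Fintype.linearIndependent_iff.mp hF (Matrix.vecMul g P) ?_ j
    rw [← hg]
    simp only [combine, Finset.smul_sum, Matrix.vecMul, dotProduct, Finset.sum_smul, smul_smul]
    exact Finset.sum_comm
  have h2 := congrArg (Matrix.vecMul · P⁻¹) h1
  simp only [Matrix.vecMul_vecMul, Matrix.zero_vecMul] at h2
  rw [Matrix.mul_nonsing_inv _ ((Matrix.isUnit_iff_isUnit_det P).mp hP), Matrix.vecMul_one] at h2
  exact fun i => congrFun h2 i

/-- The vectors `v i` are the linear parts of the `F i` along the direction of a base point.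
Comparing powers of `t` in `∑ Fᵢ(x + tp)² = 0` makes their common image isotropic and orthogonal to
`F(x)`; the dimension `r` of this image decides. -/
theorem isConicType_of_rank_five {V : Submodule ℂ (MvPolynomial (Fin 4) ℂ)} (hV : GoodSystem V)
    {F : Fin 5 → MvPolynomial (Fin 4) ℂ} (hFV : ∀ i, F i ∈ V) (hF : LinearIndependent ℂ F)
    (hq : ∀ x, ∑ i, eval x (F i) ^ 2 = 0) : IsConicType V := by
  obtain ⟨p, hp, hbase⟩ := hV.base
  choose v hv using fun i => exists_polar (hV.hom _ (hFV i)) p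
  have hpol : ∀ i x t, eval (x + t • p) (F i) = eval x (F i) + t * (v i ⬝ᵥ x) := by
    intro i x t
    rw [hv, hbase _ (hFV i)]
    ring
  have hexp : ∀ x t, 2 * t * ∑ i, eval x (F i) * (v i ⬝ᵥ x) + t ^ 2 * ∑ i, (v i ⬝ᵥ x) ^ 2 = 0 := by
    intro x t
    have h1 := hq (x + t • p)
    simp only [hpol] at h1
    rw [← h1, Finset.mul_sum, Finset.mul_sum, ← Finset.sum_add_distrib, ← sub_eq_zero,
      ← Finset.sum_sub_distrib, ← neg_eq_zero, ← Finset.sum_neg_distrib, ← hq x]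
    exact Finset.sum_congr rfl fun i _ => by ring
  have hFL : ∀ x, ∑ i, eval x (F i) * (v i ⬝ᵥ x) = 0 := by
    intro x
    linear_combination (hexp x 1 - hexp x (-1)) / 4
  have hLL : ∀ x, ∑ i, (v i ⬝ᵥ x) ^ 2 = 0 := by
    intro x
    linear_combination (hexp x 1 + hexp x (-1)) / 2
  obtain ⟨r, w, l, hw, hl, hwx, hM⟩ := exists_rank_factorization (Matrix.of v)
  have hvx : ∀ i x, v i ⬝ᵥ x = ∑ k, w k i * (l k ⬝ᵥ x) := by
    intro i x
    simp only [dotProduct, Finset.mul_sum]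
    rw [Finset.sum_comm]
    refine Finset.sum_congr rfl fun j _ => ?_
    have := hM i j
    rw [Matrix.of_apply] at this
    rw [this, Finset.sum_mul]
    exact Finset.sum_congr rfl fun k _ => by ring
  have hiso : ∀ k k', w k ⬝ᵥ w k' = 0 := by
    intro k k'
    obtain ⟨x, hx⟩ := hwx k
    obtain ⟨y, hy⟩ := hwx k'
    have h1 : ∀ z, (Matrix.of v).mulVec z ⬝ᵥ (Matrix.of v).mulVec z = 0 := by
      intro z
      rw [← hLL z]
      exact Finset.sum_congr rfl fun i _ => (pow_two _).symm
    have h2 := h1 (x + y)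
    have hxx := h1 x
    have hyy := h1 y
    rw [Matrix.mulVec_add, dotProduct_add, add_dotProduct, add_dotProduct, hx, hy,
      dotProduct_comm (w k') (w k)] at h2
    rw [hx] at hxx
    rw [hy] at hyy
    linear_combination (h2 - hxx - hyy) / 2
  have hr : r ≤ 2 := by
    have := rank_le_of_isotropic hw hiso
    omega
  interval_cases r
  · exfalso
    obtain ⟨g, _, -, hs, hgv⟩ := hV.exists_generators hF hFV
    obtain ⟨D, hD, hinj⟩ := hV.inj
    obtain ⟨i, hi⟩ := Function.ne_iff.mp hp
    obtain ⟨j, hj⟩ := exists_ne i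
    have hne : linForm (p i • Pi.single j 1 - p j • Pi.single i 1) ≠ 0 := by
      intro h
      have := congrFun (linForm_eq_zero.mp h) j
      simp [hj] at this
      exact hi this
    obtain ⟨x, hx⟩ := exists_eval_ne_zero (mul_ne_zero hD hne)
    simp only [map_mul, mul_ne_zero_iff, eval_linForm] at hx
    -- With `r = 0` the quadrics are invariant under translation by `p`. The point `x` is chosen not
    -- proportional to `p` in the coordinates `i`, `j`.
    obtain ⟨t, ht⟩ := hinj x (x + p) 1 hx.1 one_ne_zero (fun f hf => by
      rw [← mem_proportionalAt]
      have : V ≤ proportionalAt x (x + p) 1 := by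
        rw [← hs, Submodule.span_le]
        rintro _ ⟨k, rfl⟩
        have hgk : g k = F k := hgv k
        have := hpol k x 1
        rw [hvx] at this
        rw [hgk, SetLike.mem_coe, mem_proportionalAt]
        simpa using this
      exact this hf)
    apply hx.2
    have e1 := congrFun ht i
    have e2 := congrFun ht j
    simp only [Pi.add_apply, Pi.smul_apply, smul_eq_mul] at e1 e2
    simp [sub_dotProduct]
    linear_combination x j * e1 - x i * e2
  · exfalso
    -- With `r = 1` orthogonality is a product of a nonzero linear form and a nontrivial combination
    -- of the `F i`.
    have h1 : linForm (l 0) * ∑ i, w 0 i • F i = 0 := by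
      apply MvPolynomial.funext
      intro x
      rw [map_mul, eval_linForm, map_sum, map_zero, ← hFL x, Finset.mul_sum]
      refine Finset.sum_congr rfl fun i _ => ?_
      rw [hvx, smul_eval, Fin.sum_univ_one]
      ring
    have h2 := (mul_eq_zero.mp h1).resolve_left fun h => hl.ne_zero 0 (linForm_eq_zero.mp h)
    exact hw.ne_zero 0 (funext (Fintype.linearIndependent_iff.mp hF _ h2))
  · have hw' : w = ![w 0, w 1] := by
      ext i j
      fin_cases i <;> rfl
    have hl' : l = ![l 0, l 1] := by
      ext i j
      fin_cases i <;> rfl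
    -- With `r = 2` orthogonality is a syzygy between the combinations of the `F i` by `w 0` and `w
    -- 1`, the first two vectors of the Witt basis.
    obtain ⟨P, hP, hP0, hP1, hPJ⟩ := exists_witt_basis (hw' ▸ hw) (hiso 0 0) (hiso 0 1) (hiso 1 1)
    refine isConicType_of_syzygy (hl' ▸ hl) (linearIndependent_combine hP hF)
      (fun i => V.sum_mem fun j _ => V.smul_mem _ (hFV j)) (fun i => hV.hom _
        (V.sum_mem fun j _ => V.smul_mem _ (hFV j))) ?_ ?_
    · apply MvPolynomial.funext
      intro x
      simp only [map_add, map_mul, eval_linForm, combine, map_sum, smul_eval, hP0, hP1, map_zero]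
      rw [← hFL x, Finset.mul_sum, Finset.mul_sum, ← Finset.sum_add_distrib]
      refine Finset.sum_congr rfl fun i _ => ?_
      rw [hvx, Fin.sum_univ_two]
      ring
    · apply MvPolynomial.funext
      intro x
      simp only [map_add, map_mul, map_pow, eval_combine, map_zero, map_ofNat]
      set y : Fin 5 → ℂ := fun j => eval x (F j) with hy
      have h1 : y ⬝ᵥ y = 0 := by
        rw [← hq x]
        exact Finset.sum_congr rfl fun i _ => (pow_two _).symm
      have h2 : y ⬝ᵥ (1 : Matrix (Fin 5) (Fin 5) ℂ).mulVec y = 0 := by rwa [Matrix.one_mulVec]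
      rw [← hPJ, ← Matrix.mulVec_mulVec, ← Matrix.mulVec_mulVec, Matrix.dotProduct_mulVec,
        Matrix.vecMul_transpose] at h2
      generalize P.mulVec y = z at h2
      simp [Matrix.mulVec, dotProduct, Fin.sum_univ_five] at h2
      linear_combination h2

/-! ### Normal form and rank of a quadratic form. -/

/-- A complex quadratic form is a sum of squares of independent linear forms. -/
theorem exists_sum_squares {n : ℕ} {q : MvPolynomial (Fin n) ℂ} (hq : q.IsHomogeneous 2) :
    ∃ (k : ℕ) (l : Fin k → Fin n → ℂ), LinearIndependent ℂ l ∧ q = ∑ i, linForm (l i) ^ 2 := by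
  obtain ⟨c, rfl⟩ := exists_eq_sum_of_isHomogeneous_two hq
  let Q : QuadraticForm ℂ (Fin n → ℂ) :=
    ∑ i, ∑ j, c i j • QuadraticMap.linMulLin (LinearMap.proj i) (LinearMap.proj j)
  have : Invertible (2 : ℂ) := invertibleOfNonzero two_ne_zero
  obtain ⟨w, ⟨e⟩⟩ := Q.equivalent_weightedSumSquares
  have hr : ∀ i, ∃ r : ℂ, r ^ 2 = w i := fun i => IsAlgClosed.exists_pow_nat_eq _ (by norm_num)
  choose r hr using hr
  let φ : Fin (Module.finrank ℂ (Fin n → ℂ)) → (Fin n → ℂ) →ₗ[ℂ] ℂ :=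
    fun i => LinearMap.proj i ∘ₗ e.toLinearEquiv.toLinearMap
  let m : Fin (Module.finrank ℂ (Fin n → ℂ)) → Fin n → ℂ := fun i j => φ i (Pi.single j 1)
  have hm : ∀ y i, m i ⬝ᵥ y = e y i := by
    intro y i
    change _ = φ i y
    conv_rhs => rw [← Finset.univ_sum_single y]
    rw [map_sum, dotProduct]
    refine Finset.sum_congr rfl fun j _ => ?_
    rw [mul_comm, ← smul_eq_mul, ← map_smul, ← Pi.single_smul, smul_eq_mul, mul_one]
  have hmli : LinearIndependent ℂ m := by
    rw [Fintype.linearIndependent_iff]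
    intro g hg i
    have h1 := congrArg (· ⬝ᵥ e.symm (Pi.single i 1)) hg
    simp only [sum_dotProduct, smul_dotProduct, hm, zero_dotProduct] at h1
    rw [Finset.sum_eq_single i] at h1
    · simpa using h1
    · intro j _ hj
      simp [hj]
    · exact fun h => absurd (Finset.mem_univ i) h
  -- Only the nonzero weights are kept, and their square roots are absorbed into the linear forms.
  let σ := Fintype.equivFin {i // r i ≠ 0}
  refine ⟨_, fun k => r (σ.symm k) • m (σ.symm k), ?_, ?_⟩
  · have h1 := (hmli.comp (fun i : {i // r i ≠ 0} => (i : Fin _)) Subtype.val_injective).units_smul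
      (fun i => Units.mk0 (r i) i.2)
    exact h1.comp σ.symm σ.symm.injective
  · apply MvPolynomial.funext
    intro y
    have h1 := e.map_app y
    rw [QuadraticMap.weightedSumSquares_apply] at h1
    have h2 : eval y (∑ i, ∑ j, c i j • (X i * X j)) = Q y := by
      simp [Q, smul_eval]
    rw [h2, ← h1]
    simp only [map_sum, map_pow, eval_linForm, smul_dotProduct, hm, smul_eq_mul]
    rw [σ.symm.sum_comp (fun i => (r i * e y i) ^ 2)]
    rw [← Finset.sum_subtype (Finset.univ.filter fun i => r i ≠ 0) (by simp)
      (fun i => (r i * e y i) ^ 2), Finset.sum_filter_of_ne]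
    · exact Finset.sum_congr rfl fun i _ => by rw [← hr]; ring
    · intro i _ hi h0
      simp [h0] at hi

/-- The matrix of second derivatives is `2 LᵀL`, where `L` has the independent rows `l i`. As `L` is
surjective, the rank is that of `Lᵀ`. -/
theorem quadricRank_sum_squares {n k : ℕ} {l : Fin k → Fin n → ℂ} (hl : LinearIndependent ℂ l) :
    quadricRank (∑ i, linForm (l i) ^ 2) = k := by
  have hpd : ∀ (v : Fin n → ℂ) (i : Fin n), pderiv i (linForm v) = C (v i) := by
    intro v i
    simp [linForm_apply, pderiv_X, Pi.single_apply, smul_eq_C_mul]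
  have hmat : (Matrix.of fun i j : Fin n => coeff 0 (pderiv i (pderiv j
      (∑ i, linForm (l i) ^ 2)))) = (2 : ℂ) • ((Matrix.of l).transpose * Matrix.of l) := by
    ext i j
    simp only [Matrix.of_apply, map_sum, coeff_sum, Matrix.smul_apply, Matrix.mul_apply,
      Matrix.transpose_apply, smul_eq_mul]
    rw [Finset.mul_sum]
    refine Finset.sum_congr rfl fun a _ => ?_
    rw [pow_two, Derivation.leibniz, hpd]
    simp only [smul_eq_mul, map_add, Derivation.leibniz, hpd, pderiv_C, mul_zero, zero_add]
    simp only [← C_mul, coeff_add, coeff_zero_C]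
    ring
  rw [quadricRank, hmat]
  have hrank : (Matrix.of l).rank = k := by
    have := LinearIndependent.rank_matrix (M := Matrix.of l) hl
    simpa using this
  have htop : LinearMap.range (Matrix.of l).mulVecLin = ⊤ :=
    Submodule.eq_top_of_finrank_eq (hrank.trans (by simp))
  have h1 : ((2 : ℂ) • ((Matrix.of l).transpose * Matrix.of l)).rank =
      ((Matrix.of l).transpose * Matrix.of l).rank :=
    Matrix.rank_smul_of_mem_nonZeroDivisors _ (mem_nonZeroDivisors_of_ne_zero two_ne_zero)
  rw [h1, Matrix.rank, Matrix.mulVecLin_mul, LinearMap.range_comp_of_range_eq_top _ htop]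
  exact (Matrix.rank_transpose _).trans hrank

theorem not_irreducible_linForm_mul {n : ℕ} (a b : Fin n → ℂ) :
    ¬ Irreducible (linForm a * linForm b) := by
  intro h
  have hu : ∀ v : Fin n → ℂ, ¬ IsUnit (linForm v) := by
    intro v hv
    have := hv.map (eval (0 : Fin n → ℂ))
    rw [eval_linForm, dotProduct_zero] at this
    exact not_isUnit_zero this
  rcases h.isUnit_or_isUnit rfl with h | h
  · exact hu _ h
  · exact hu _ h

/-! ### From the birational map to its linear system. -/

theorem aeval_smul_of_isHomogeneous {k d : ℕ} {A : Type*} [CommRing A] [Algebra ℂ A]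
    {g : MvPolynomial (Fin k) ℂ} (hg : g.IsHomogeneous d) (c : A) (x : Fin k → A) :
    aeval (c • x) g = c ^ d * aeval x g := by
  rw [aeval_def, aeval_def, eval₂_eq, eval₂_eq, Finset.mul_sum]
  refine Finset.sum_congr rfl fun m hm => ?_
  have h : ∑ i ∈ m.support, m i = d := by
    have h' := hg (MvPolynomial.mem_support_iff.mp hm)
    simpa [Finsupp.weight_apply, Finsupp.sum] using h'
  simp only [Pi.smul_apply, smul_eq_mul, mul_pow, Finset.prod_mul_distrib,
    Finset.prod_pow_eq_pow_sum, h]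
  ring

/-- A form some power of which lies in the ideal of a reduced projective scheme vanishes at its
points with values in any algebra. -/
theorem ZeroSchemeIsReduced.aeval_eq_zero {k m : ℕ} {F : Fin m → MvPolynomial (Fin k) ℂ}
    (hred : ZeroSchemeIsReduced F) {e : ℕ} (hF : ∀ j, (F j).IsHomogeneous e)
    {f : MvPolynomial (Fin k) ℂ} {d n : ℕ} (hf : f.IsHomogeneous d)
    (hn : f ^ n ∈ Ideal.span (Set.range F)) {A : Type*} [CommRing A] [Algebra ℂ A]
    {x : Fin k → A} {i : Fin k} (hi : IsUnit (x i)) (hx : ∀ j, aeval x (F j) = 0) :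
    aeval x f = 0 := by
  obtain ⟨u, hu⟩ := hi
  set y : Fin k → A := (↑u⁻¹ : A) • x with hy
  have hyi : y i = 1 := by
    rw [hy, Pi.smul_apply, ← hu, smul_eq_mul, Units.inv_mul]
  let ψ : MvPolynomial {j : Fin k // j ≠ i} ℂ →ₐ[ℂ] A := aeval fun j => y j
  have hψ : ∀ g, ψ (dehomogenize i g) = aeval y g := by
    intro g
    have : ψ.comp (dehomogenize i) = aeval (R := ℂ) y := by
      ext j
      simp only [dehomogenize, AlgHom.comp_apply, aeval_X]
      split_ifs with h
      · rw [map_one, h, hyi]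
      · simp [ψ]
    exact DFunLike.congr_fun this g
  -- In the reduced coordinate ring of the chart the nilpotent class of `f` is zero; the point,
  -- scaled to `y i = 1`, factors through this ring.
  have hmem : dehomogenize i f ∈ chartIdeal F i := by
    have := hred i
    have h1 : dehomogenize i f ^ n ∈ chartIdeal F i := by
      have := Ideal.mem_map_of_mem (dehomogenize i) hn
      rw [Ideal.map_span, ← Set.range_comp, map_pow] at this
      exact this
    rw [← Ideal.Quotient.eq_zero_iff_mem, map_pow] at h1
    rw [← Ideal.Quotient.eq_zero_iff_mem]
    exact IsNilpotent.eq_zero ⟨n, h1⟩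
  have hker : chartIdeal F i ≤ RingHom.ker ψ := by
    rw [chartIdeal, Ideal.span_le]
    rintro _ ⟨j, rfl⟩
    rw [SetLike.mem_coe, RingHom.mem_ker, hψ, hy, aeval_smul_of_isHomogeneous (hF j), hx, mul_zero]
  have h2 := hker hmem
  rw [RingHom.mem_ker, hψ, hy, aeval_smul_of_isHomogeneous hf] at h2
  exact ((u⁻¹.isUnit.pow d).mul_right_eq_zero).mp h2

theorem IsQuadraticBirationalOntoQuadric.eval_eq_zero {n : ℕ}
    {F : Fin (n + 2) → MvPolynomial (Fin (n + 1)) ℂ} {q : MvPolynomial (Fin (n + 2)) ℂ}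
    (hF : IsQuadraticBirationalOntoQuadric F q) {d : ℕ} {g : MvPolynomial (Fin (n + 2)) ℂ}
    (hg : g.IsHomogeneous d) (h : ∀ x, eval (evalForms F x) g = 0) {y : Fin (n + 2) → ℂ}
    (hy : y ≠ 0) (hq : eval y q = 0) : eval y g = 0 := by
  have h1 : Projectivization.mk ℂ y hy ∈ zariskiClosure (imageSet F) := by
    rw [hF.closure_image]
    exact (vanishesAt_mk hF.quadric y hy).mpr hq
  refine (vanishesAt_mk hg y hy).mp (h1 d g hg ?_)
  rintro _ ⟨p, x, hx, hFx, rfl, rfl⟩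
  exact (vanishesAt_mk hg _ hFx).mpr (h x)

theorem IsQuadraticBirationalOntoQuadric.eval_quadric {n : ℕ}
    {F : Fin (n + 2) → MvPolynomial (Fin (n + 1)) ℂ} {q : MvPolynomial (Fin (n + 2)) ℂ}
    (hF : IsQuadraticBirationalOntoQuadric F q) (x : Fin (n + 1) → ℂ) :
    eval (evalForms F x) q = 0 := by
  by_cases hFx : evalForms F x = 0
  · have := eval_smul_of_isHomogeneous hF.quadric 0 (0 : Fin (n + 2) → ℂ)
    rw [hFx]
    simpa using this
  · have hx : x ≠ 0 := by
      rintro rfl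
      apply hFx
      ext i
      have := eval_smul_of_isHomogeneous (hF.quadratic i) 0 (0 : Fin (n + 1) → ℂ)
      simpa [evalForms] using this
    have h1 : Projectivization.mk ℂ _ hFx ∈ hypersurface q := by
      rw [← hF.closure_image]
      intro d g _ hz
      exact hz _ ⟨_, x, hx, hFx, rfl, rfl⟩
    exact (vanishesAt_mk hF.quadric _ hFx).mp h1

/-- A linear relation is a linear form vanishing on `V(q)`. By the Nullstellensatz the prime `q`
divides it, which its degree forbids unless it is zero. -/
theorem IsQuadraticBirationalOntoQuadric.linearIndependent {n : ℕ}
    {F : Fin (n + 2) → MvPolynomial (Fin (n + 1)) ℂ} {q : MvPolynomial (Fin (n + 2)) ℂ}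
    (hF : IsQuadraticBirationalOntoQuadric F q) : LinearIndependent ℂ F := by
  rw [Fintype.linearIndependent_iff]
  intro c hc
  have hvan : ∀ y, eval y q = 0 → eval y (linForm c) = 0 := by
    intro y hy
    by_cases hy0 : y = 0
    · rw [hy0, eval_linForm, dotProduct_zero]
    · refine hF.eval_eq_zero (linForm_isHomogeneous c) (fun x => ?_) hy0 hy
      have := congrArg (eval x) hc
      simpa [eval_linForm, evalForms, dotProduct, smul_eval] using this
  have hprime : (Ideal.span {q}).IsPrime :=
    (Ideal.span_singleton_prime hF.irreducible_quadric.ne_zero).mpr hF.irreducible_quadric.prime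
  have hmem : linForm c ∈ Ideal.span {q} := by
    rw [← IsPrime.vanishingIdeal_zeroLocus (K := ℂ) (Ideal.span {q})]
    rw [mem_vanishingIdeal_iff]
    intro y hy
    rw [aeval_eq_eval]
    refine hvan y ?_
    have := hy q (Ideal.mem_span_singleton_self q)
    rwa [aeval_eq_eval] at this
  obtain ⟨u, hu⟩ := Ideal.mem_span_singleton.mp hmem
  have hc0 : linForm c = 0 := by
    by_contra h0
    have hom := linForm_isHomogeneous c
    rw [hu] at hom h0
    obtain ⟨i, j, hij, hi, hj⟩ := isHomogeneous_of_mul hom h0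
    have := hi.inj_right hF.quadric hF.irreducible_quadric.ne_zero
    omega
  exact fun i => congrFun (linForm_eq_zero.mp hc0) i

theorem evalForms_ne_zero {k m : ℕ} {F : Fin m → MvPolynomial (Fin k) ℂ} {x : Fin k → ℂ} {i : Fin m}
    (h : eval x (F i) ≠ 0) : evalForms F x ≠ 0 := fun h0 => h (congrFun h0 i)

theorem ne_zero_of_evalForms_ne_zero {k m d : ℕ} {F : Fin m → MvPolynomial (Fin k) ℂ}
    (hF : ∀ i, (F i).IsHomogeneous (d + 1)) {x : Fin k → ℂ} (h : evalForms F x ≠ 0) : x ≠ 0 := by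
  rintro rfl
  apply h
  ext i
  have := eval_smul_of_isHomogeneous (hF i) 0 (0 : Fin k → ℂ)
  simpa [evalForms] using this

theorem eval_bind₁_forms {k m : ℕ} (F : Fin m → MvPolynomial (Fin k) ℂ)
    (g : MvPolynomial (Fin m) ℂ) (x : Fin k → ℂ) :
    eval x (bind₁ F g) = eval (evalForms F x) g := by
  rw [← aeval_eq_eval, aeval_bind₁, aeval_eq_eval]
  rfl

/-- The forms that define the inverse do not all vanish on the image. -/
theorem IsInverseOfDegree.exists_ne_zero {n d : ℕ}
    {F : Fin (n + 2) → MvPolynomial (Fin (n + 1)) ℂ} {q : MvPolynomial (Fin (n + 2)) ℂ}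
    {G : Fin (n + 1) → MvPolynomial (Fin (n + 2)) ℂ} (hG : IsInverseOfDegree F q d G)
    (hF : IsQuadraticBirationalOntoQuadric F q) : ∃ j, bind₁ F (G j) ≠ 0 := by
  by_contra! hcon
  obtain ⟨y, hy, p, z, hz, hGz, rfl, -⟩ := hG.defined
  apply hGz
  ext j
  refine hF.eval_eq_zero (hG.homogeneous j) (fun x => ?_) hz
    ((vanishesAt_mk hF.quadric z hz).mp hy)
  have := congrArg (eval x) (hcon j)
  rwa [eval_bind₁_forms, map_zero] at this

theorem IsQuadraticBirationalOntoQuadric.goodSystem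
    {F : Fin (3 + 2) → MvPolynomial (Fin (3 + 1)) ℂ} {q : MvPolynomial (Fin (3 + 2)) ℂ}
    (hF : IsQuadraticBirationalOntoQuadric F q) (hne : (zeroSet F).Nonempty)
    (hred : ZeroSchemeIsReduced F) : GoodSystem (Submodule.span ℂ (Set.range F)) where
  hom := by
    intro f hf
    have : Submodule.span ℂ (Set.range F) ≤ homogeneousSubmodule (Fin 4) ℂ 2 := by
      rw [Submodule.span_le]
      rintro _ ⟨i, rfl⟩
      exact hF.quadratic i
    exact this hf
  finrank_eq := by
    rw [finrank_span_eq_card hF.linearIndependent]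
    simp
  inj := by
    obtain ⟨d, G, hG⟩ := hF.birational
    obtain ⟨j, hj⟩ := hG.exists_ne_zero hF
    -- Where this product is nonzero, `φ` is defined at `x` and its inverse at `φ(x)`, so points
    -- with the same image coincide.
    refine ⟨bind₁ F (G j) * F 0, mul_ne_zero hj (hF.linearIndependent.ne_zero 0), ?_⟩
    intro x x' c hx hc hxx
    rw [map_mul, mul_ne_zero_iff, eval_bind₁_forms] at hx
    have hFx := evalForms_ne_zero hx.2
    have hGx : evalForms G (evalForms F x) ≠ 0 := evalForms_ne_zero hx.1
    have hFx' : evalForms F x' = c • evalForms F x := by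
      ext i
      exact hxx _ (Submodule.subset_span ⟨i, rfl⟩)
    have hFx'0 : evalForms F x' ≠ 0 := by
      rw [hFx']
      exact smul_ne_zero hc hFx
    have hx0 := ne_zero_of_evalForms_ne_zero (d := 1) hF.quadratic hFx
    have hx'0 := ne_zero_of_evalForms_ne_zero (d := 1) hF.quadratic hFx'0
    have hy : Projectivization.mk ℂ _ hFx = Projectivization.mk ℂ _ hFx'0 := by
      rw [eq_comm, Projectivization.mk_eq_mk_iff']
      exact ⟨c, hFx'.symm⟩
    have e1 := hG.left_inv _ _ (Projectivization.mk ℂ _ hGx) ⟨x, hx0, hFx, rfl, rfl⟩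
      ⟨_, hFx, hGx, rfl, rfl⟩
    have e2 := hG.left_inv _ _ (Projectivization.mk ℂ _ hGx) ⟨x', hx'0, hFx'0, rfl, rfl⟩
      ⟨_, hFx, hGx, hy.symm, rfl⟩
    rw [e1, eq_comm, Projectivization.mk_eq_mk_iff'] at e2
    obtain ⟨t, ht⟩ := e2
    exact ⟨t, ht.symm⟩
  red := by
    intro f d n hf hn x hx hg
    obtain ⟨i, hi⟩ := hx
    refine hred.aeval_eq_zero hF.quadratic hf (n := n) ?_ (x := x) (i := i)
      (TrivSqZeroExt.isUnit_iff_isUnit_fst.mpr (isUnit_iff_ne_zero.mpr hi))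
      (fun j => hg _ (Submodule.subset_span ⟨j, rfl⟩))
    have hle : Ideal.span (Submodule.span ℂ (Set.range F) : Set (MvPolynomial (Fin 4) ℂ)) ≤
        Ideal.span (Set.range F) := by
      rw [Ideal.span_le]
      have : Submodule.span ℂ (Set.range F) ≤ (Ideal.span (Set.range F)).restrictScalars ℂ :=
        Submodule.span_le.mpr Ideal.subset_span
      exact this
    exact hle hn
  base := by
    obtain ⟨p, hp⟩ := hne
    refine ⟨p.rep, p.rep_nonzero, fun f hf => ?_⟩
    have : Submodule.span ℂ (Set.range F) ≤ LinearMap.ker (aeval (R := ℂ) p.rep).toLinearMap := by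
      rw [Submodule.span_le]
      rintro _ ⟨i, rfl⟩
      have : eval p.rep (F i) = 0 := hp i
      simpa [aeval_eq_eval] using this
    simpa [aeval_eq_eval] using this hf

/-! ### The degree of the inverse. -/

/-- Forms that invert `φ` up to a common factor define its inverse. -/
theorem isInverseOfDegree_of_eval {n d : ℕ}
    {F : Fin (n + 2) → MvPolynomial (Fin (n + 1)) ℂ} {q : MvPolynomial (Fin (n + 2)) ℂ}
    (hF : IsQuadraticBirationalOntoQuadric F q) {G : Fin (n + 1) → MvPolynomial (Fin (n + 2)) ℂ}
    {h : MvPolynomial (Fin (n + 1)) ℂ} (hG : ∀ i, (G i).IsHomogeneous d) (h0 : h ≠ 0)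
    (hinv : ∀ x i, eval (evalForms F x) (G i) = eval x h * x i) : IsInverseOfDegree F q d G where
  homogeneous := hG
  defined := by
    obtain ⟨x, hx⟩ := exists_eval_ne_zero (mul_ne_zero (mul_ne_zero h0
      (hF.linearIndependent.ne_zero 0)) (X_ne_zero (0 : Fin (n + 1))))
    simp only [map_mul, mul_ne_zero_iff, eval_X] at hx
    have hFx := evalForms_ne_zero hx.1.2
    have hGx : evalForms G (evalForms F x) ≠ 0 := by
      refine evalForms_ne_zero (i := 0) ?_
      rw [hinv]
      exact mul_ne_zero hx.1.1 hx.2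
    exact ⟨_, (vanishesAt_mk hF.quadric _ hFx).mpr (hF.eval_quadric x),
      Projectivization.mk ℂ _ hGx, _, hFx, hGx, rfl, rfl⟩
  left_inv := by
    rintro p y p' ⟨x, hx, hFx, rfl, rfl⟩ ⟨z, hz, hGz, hy, rfl⟩
    rw [eq_comm, Projectivization.mk_eq_mk_iff'] at hy
    obtain ⟨a, rfl⟩ := hy
    rw [Projectivization.mk_eq_mk_iff']
    refine ⟨a ^ d * eval x h, ?_⟩
    ext i
    rw [evalForms, eval_smul_of_isHomogeneous (hG i), hinv, Pi.smul_apply, smul_eq_mul]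
    ring
  right_inv := by
    rintro y hy p y' ⟨z, hz, hGz, rfl, rfl⟩ ⟨x, hx, hFx, hp, rfl⟩
    rw [eq_comm, Projectivization.mk_eq_mk_iff'] at hp
    obtain ⟨a, rfl⟩ := hp
    have hq := (vanishesAt_mk hF.quadric z hz).mp hy
    -- That `F(G(z))` is proportional to `z` is expressed by forms in `z`. They vanish on the image
    -- of `φ`, hence on its closure.
    have key : ∀ i j, eval (evalForms G z) (F i) * z j = eval (evalForms G z) (F j) * z i := by
      intro i j
      have hhom : ∀ i j, (bind₁ G (F i) * X j).IsHomogeneous (d * 2 + 1) := fun i j =>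
        ((hF.quadratic i).aeval G hG).mul (isHomogeneous_X ℂ j)
      have := hF.eval_eq_zero ((hhom i j).sub (hhom j i)) (fun x => by
        have h1 : evalForms G (evalForms F x) = eval x h • x := by
          ext i
          exact hinv x i
        simp only [map_sub, map_mul, eval_bind₁_forms, h1, eval_X,
          eval_smul_of_isHomogeneous (hF.quadratic _), evalForms]
        ring) hz hq
      simpa [eval_bind₁_forms, sub_eq_zero] using this
    obtain ⟨j, hj⟩ := Function.ne_iff.mp hz
    rw [Projectivization.mk_eq_mk_iff']
    refine ⟨a ^ 2 * eval (evalForms G z) (F j) / z j, ?_⟩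
    ext i
    rw [evalForms, eval_smul_of_isHomogeneous (hF.quadratic i), Pi.smul_apply, smul_eq_mul]
    have hj' : z j ≠ 0 := hj
    field_simp
    linear_combination -a ^ 2 * key i j

/-- Constant forms would send every image point to one point, while `φ` is defined at points
different from it. -/
theorem not_isInverseOfDegree_zero {n : ℕ}
    {F : Fin (n + 1 + 2) → MvPolynomial (Fin (n + 1 + 1)) ℂ}
    {q : MvPolynomial (Fin (n + 1 + 2)) ℂ} (hF : IsQuadraticBirationalOntoQuadric F q)
    (G : Fin (n + 1 + 1) → MvPolynomial (Fin (n + 1 + 2)) ℂ) : ¬ IsInverseOfDegree F q 0 G := by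
  intro hG
  choose c hc using fun i => eq_C_of_isHomogeneous_zero (hG.homogeneous i)
  have hGc : ∀ y, evalForms G y = c := by
    intro y
    ext i
    rw [evalForms, hc, eval_C]
  obtain ⟨y, -, p, z, hz, hGz, -, -⟩ := hG.defined
  rw [hGc] at hGz
  obtain ⟨i, hi⟩ := Function.ne_iff.mp hGz
  obtain ⟨j, hj⟩ := exists_ne i
  have hne : linForm (c i • Pi.single j 1 - c j • Pi.single i 1) ≠ 0 := by
    intro h
    have := congrFun (linForm_eq_zero.mp h) j
    simp [hj] at this
    exact hi this
  obtain ⟨x, hx⟩ := exists_eval_ne_zero (mul_ne_zero (hF.linearIndependent.ne_zero 0) hne)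
  simp only [map_mul, mul_ne_zero_iff, eval_linForm] at hx
  have hFx := evalForms_ne_zero hx.1
  have hx0 := ne_zero_of_evalForms_ne_zero (d := 1) hF.quadratic hFx
  have hGx : evalForms G (evalForms F x) ≠ 0 := by rwa [hGc]
  have e1 := hG.left_inv _ _ (Projectivization.mk ℂ _ hGx) ⟨x, hx0, hFx, rfl, rfl⟩
    ⟨_, hFx, hGx, rfl, rfl⟩
  rw [Projectivization.mk_eq_mk_iff'] at e1
  obtain ⟨a, ha⟩ := e1
  rw [hGc] at ha
  apply hx.2
  simp [sub_dotProduct, ← ha]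
  ring

theorem exists_linForm_of_mem_span {n m : ℕ} {F : Fin n → MvPolynomial (Fin m) ℂ}
    {f : MvPolynomial (Fin m) ℂ} (hf : f ∈ Submodule.span ℂ (Set.range F)) :
    ∃ v, ∀ x, eval (evalForms F x) (linForm v) = eval x f := by
  obtain ⟨v, rfl⟩ := (Submodule.mem_span_range_iff_exists_fun ℂ).mp hf
  exact ⟨v, fun x => by simp [eval_linForm, dotProduct, evalForms, smul_eval]⟩

theorem isOfTypeTwo_one {F : Fin (3 + 2) → MvPolynomial (Fin (3 + 1)) ℂ}
    {q : MvPolynomial (Fin (3 + 2)) ℂ} (hF : IsQuadraticBirationalOntoQuadric F q)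
    (h : IsConicType (Submodule.span ℂ (Set.range F))) : IsOfTypeTwo F q 1 := by
  obtain ⟨m, hm, h⟩ := h
  choose v hv using fun i => exists_linForm_of_mem_span (h i)
  refine ⟨hF, ⟨fun i => linForm (v i), isInverseOfDegree_of_eval hF (h := m)
    (fun i => linForm_isHomogeneous _) hm fun x i => ?_⟩, ?_⟩
  · rw [hv, map_mul, eval_X]
  · rintro e ⟨G, hG⟩
    rcases Nat.eq_zero_or_pos e with rfl | he
    · exact absurd hG (not_isInverseOfDegree_zero hF G)
    · exact he

/-! ### The system of a line and two points. -/

/-- The quadrics through the line `X₀ = X₁ = 0` and the points `[1, 0, 0, 0]`, `[0, 1, 0, 0]`. -/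
noncomputable def lineQuadrics : Fin 5 → MvPolynomial (Fin 4) ℂ :=
  ![X 0 * X 2, X 0 * X 3, X 1 * X 2, X 1 * X 3, X 0 * X 1]

theorem linearIndependent_lineQuadrics : LinearIndependent ℂ lineQuadrics := by
  rw [Fintype.linearIndependent_iff]
  intro g hg
  have h1 := congrArg (eval ![1, 0, 1, 0]) hg
  have h2 := congrArg (eval ![1, 0, 0, 1]) hg
  have h3 := congrArg (eval ![0, 1, 1, 0]) hg
  have h4 := congrArg (eval ![0, 1, 0, 1]) hg
  have h5 := congrArg (eval ![1, 1, 0, 0]) hg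
  simp [lineQuadrics, Fin.sum_univ_five, smul_eval] at h1 h2 h3 h4 h5
  intro i
  fin_cases i <;> simpa

theorem IsLineType.exists_span_eq {V : Submodule ℂ (MvPolynomial (Fin 4) ℂ)} (hV : GoodSystem V)
    (h : IsLineType V) : ∃ T : Matrix (Fin 4) (Fin 4) ℂ, IsUnit T ∧
      Submodule.span ℂ (Set.range fun k => subst T (lineQuadrics k)) = V := by
  obtain ⟨T, hT, h0, h1, h2, h3, h4⟩ := h
  have hli : LinearIndependent ℂ fun k => subst T (lineQuadrics k) :=
    linearIndependent_lineQuadrics.map' (subst T).toLinearMap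
      (LinearMap.ker_eq_bot.mpr (subst_injective hT))
  obtain ⟨g, _, -, hs, hg⟩ := hV.exists_generators hli (fun k => by
    fin_cases k
    exacts [h0, h1, h2, h3, h4])
  have : g = fun k => subst T (lineQuadrics k) := funext hg
  exact ⟨T, hT, this ▸ hs⟩

theorem lineQuadrics_eval_eq_zero_iff (z : Fin 4 → ℂ) : (∀ k, eval z (lineQuadrics k) = 0) ↔
    (z 0 = 0 ∧ z 1 = 0) ∨ (z 1 = 0 ∧ z 2 = 0 ∧ z 3 = 0) ∨ (z 0 = 0 ∧ z 2 = 0 ∧ z 3 = 0) := by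
  simp only [Fin.forall_fin_succ, lineQuadrics]
  simp
  grind

theorem isInverse_two_of_span_eq {F : Fin (3 + 2) → MvPolynomial (Fin (3 + 1)) ℂ}
    {q : MvPolynomial (Fin (3 + 2)) ℂ} (hF : IsQuadraticBirationalOntoQuadric F q)
    {T : Matrix (Fin 4) (Fin 4) ℂ} (hT : IsUnit T)
    (hs : Submodule.span ℂ (Set.range fun k => subst T (lineQuadrics k)) =
      Submodule.span ℂ (Set.range F)) : ∃ G, IsInverseOfDegree F q 2 G := by
  choose v hv using fun k => exists_linForm_of_mem_span (F := F)
    (hs ▸ Submodule.subset_span ⟨k, rfl⟩ : subst T (lineQuadrics k) ∈ _)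
  -- With `y` the five quadrics in order, `y₄y₀`, `y₄y₂`, `y₀y₂`, `y₁y₂` are `X 0 * X 1 * X 2` times
  -- the four coordinates.
  let a : Fin 4 → Fin 5 → ℂ := ![v 4, v 4, v 0, v 1]
  let b : Fin 4 → Fin 5 → ℂ := ![v 0, v 2, v 2, v 2]
  have hdet := (Matrix.isUnit_iff_isUnit_det T).mp hT
  refine ⟨fun i => ∑ m, C (T⁻¹ i m) * (linForm (a m) * linForm (b m)),
    isInverseOfDegree_of_eval hF (h := subst T (X 0 * X 1 * X 2)) (fun i => ?_) ?_ ?_⟩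
  · exact IsHomogeneous.sum _ _ _ fun m _ =>
      ((linForm_isHomogeneous _).mul (linForm_isHomogeneous _)).C_mul _
  · intro h0
    rw [← map_zero (subst T)] at h0
    exact mul_ne_zero (mul_ne_zero (X_ne_zero 0) (X_ne_zero 1)) (X_ne_zero 2)
      (subst_injective hT h0)
  · intro x i
    have hx : x = T⁻¹.mulVec (T.mulVec x) := by
      rw [Matrix.mulVec_mulVec, Matrix.nonsing_inv_mul _ hdet, Matrix.one_mulVec]
    have hxi : x i = ∑ m, T⁻¹ i m * T.mulVec x m := congrFun hx i
    have hab : ∀ m, eval (evalForms F x) (linForm (a m)) * eval (evalForms F x) (linForm (b m)) =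
        eval x (subst T (X 0 * X 1 * X 2)) * T.mulVec x m := by
      intro m
      fin_cases m <;> simp only [a, b, Fin.reduceFinMk, Fin.zero_eta, Fin.mk_one, Matrix.cons_val,
        hv, eval_subst, lineQuadrics] <;> simp <;> ring
    rw [map_sum]
    simp only [map_mul, eval_C, hab]
    rw [hxi, ← map_mul, ← map_mul, Finset.mul_sum]
    exact Finset.sum_congr rfl fun m _ => by ring

/-- Linear forms `G` would give `G(F) = h · X` with `h` linear. All `F j` vanish on the base locus,
hence so does `h`; but in the coordinates `T` the base locus contains the four coordinate points, so
`h = 0`. -/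
theorem not_isInverse_one_of_span_eq {F : Fin (3 + 2) → MvPolynomial (Fin (3 + 1)) ℂ}
    {q : MvPolynomial (Fin (3 + 2)) ℂ} (hF : IsQuadraticBirationalOntoQuadric F q)
    {T : Matrix (Fin 4) (Fin 4) ℂ} (hT : IsUnit T)
    (hs : Submodule.span ℂ (Set.range fun k => subst T (lineQuadrics k)) =
      Submodule.span ℂ (Set.range F)) (G : Fin 4 → MvPolynomial (Fin 5) ℂ) :
    ¬ IsInverseOfDegree F q 1 G := by
  intro hG
  obtain ⟨j₀, hj₀⟩ := hG.exists_ne_zero hF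
  have hrel : ∀ i j, bind₁ F (G i) * X j = bind₁ F (G j) * X i := by
    intro i j
    apply MvPolynomial.funext
    intro x
    simp only [map_mul, eval_bind₁_forms, eval_X]
    have hhom0 : ∀ i, eval (0 : Fin 5 → ℂ) (G i) = 0 := by
      intro i
      have := eval_smul_of_isHomogeneous (hG.homogeneous i) 0 (0 : Fin 5 → ℂ)
      simpa using this
    by_cases hFx : evalForms F x = 0
    · have : ∀ i, eval (evalForms F x) (G i) = 0 := fun i => by
        rw [hFx]
        exact hhom0 i
      rw [this, this]
      ring
    by_cases hGx : evalForms G (evalForms F x) = 0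
    · have : ∀ i, eval (evalForms F x) (G i) = 0 := fun i => congrFun hGx i
      rw [this, this]
      ring
    · have hx0 := ne_zero_of_evalForms_ne_zero (d := 1) hF.quadratic hFx
      have e1 := hG.left_inv _ _ (Projectivization.mk ℂ _ hGx) ⟨x, hx0, hFx, rfl, rfl⟩
        ⟨_, hFx, hGx, rfl, rfl⟩
      rw [Projectivization.mk_eq_mk_iff'] at e1
      obtain ⟨a, ha⟩ := e1
      have : ∀ i, eval (evalForms F x) (G i) = a * x i := fun i => (congrFun ha i).symm
      rw [this, this]
      ring
  have hP : ∀ i, (bind₁ F (G i)).IsHomogeneous 2 := fun i =>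
    (hG.homogeneous i).aeval F hF.quadratic
  have hX01 : ¬ (X 0 : MvPolynomial (Fin 4) ℂ) ∣ X 1 := by
    rintro ⟨u, hu⟩
    have := congrArg (eval ![0, 1, 0, 0]) hu
    simp at this
  have hX0 : Prime (X 0 : MvPolynomial (Fin 4) ℂ) := by
    rw [← linForm_single]
    exact prime_linForm (by simp)
  obtain ⟨h, hh⟩ : (X 0 : MvPolynomial (Fin 4) ℂ) ∣ bind₁ F (G 0) :=
    (hX0.dvd_or_dvd ⟨_, (hrel 0 1).trans (mul_comm _ _)⟩).resolve_right hX01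
  have hPh : ∀ i, bind₁ F (G i) = h * X i := by
    intro i
    have := hrel i 0
    rw [hh] at this
    exact mul_right_cancel₀ (X_ne_zero 0) (by rw [this]; ring)
  have hh0 : h ≠ 0 := by
    rintro rfl
    exact hj₀ (by rw [hPh, zero_mul])
  have hhom : h.IsHomogeneous 1 := by
    have h1 := hP 0
    rw [hh] at h1
    exact isHomogeneous_of_mul_left (m := 1) (n := 1) h1 (mul_ne_zero (X_ne_zero 0) hh0)
      (isHomogeneous_X ℂ 0)
  obtain ⟨η, rfl⟩ := exists_eq_linForm hhom
  have hvan : ∀ x, x ≠ 0 → (∀ k, eval (T.mulVec x) (lineQuadrics k) = 0) → η ⬝ᵥ x = 0 := by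
    intro x hx hz
    obtain ⟨i, hi⟩ := Function.ne_iff.mp hx
    have hFx : evalForms F x = 0 := by
      ext j
      have hj : F j ∈ Submodule.span ℂ (Set.range fun k => subst T (lineQuadrics k)) :=
        hs ▸ Submodule.subset_span ⟨j, rfl⟩
      obtain ⟨c, hc⟩ := (Submodule.mem_span_range_iff_exists_fun ℂ).mp hj
      rw [evalForms, ← hc]
      simp [smul_eval, eval_subst, hz]
    have h1 := congrArg (eval x) (hPh i)
    rw [eval_bind₁_forms, hFx, map_mul, eval_linForm, eval_X] at h1
    have h2 : eval (0 : Fin 5 → ℂ) (G i) = 0 := by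
      have := eval_smul_of_isHomogeneous (hG.homogeneous i) 0 (0 : Fin 5 → ℂ)
      simpa using this
    rcases mul_eq_zero.mp (h1.symm.trans h2) with h3 | h3
    · exact h3
    · exact absurd h3 hi
  apply hh0
  rw [linForm_eq_zero]
  have hdet := (Matrix.isUnit_iff_isUnit_det T).mp hT
  have h3 : ∀ m, η ⬝ᵥ T⁻¹.mulVec (Pi.single m 1) = 0 := by
    intro m
    have h4 : T.mulVec (T⁻¹.mulVec (Pi.single m 1)) = Pi.single m 1 := by
      rw [Matrix.mulVec_mulVec, Matrix.mul_nonsing_inv _ hdet, Matrix.one_mulVec]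
    refine hvan _ ?_ ?_
    · intro h0
      rw [h0, Matrix.mulVec_zero] at h4
      simpa using congrFun h4 m
    · rw [h4, lineQuadrics_eval_eq_zero_iff]
      fin_cases m <;> simp
  have h5 : Matrix.vecMul η T⁻¹ = 0 := by
    ext m
    have := h3 m
    rw [Matrix.dotProduct_mulVec, dotProduct_single_one] at this
    exact this
  have h6 := congrArg (Matrix.vecMul · T) h5
  simpa [Matrix.vecMul_vecMul, Matrix.nonsing_inv_mul _ hdet] using h6

theorem eq_mk_inv_single_iff {k : ℕ} {T : Matrix (Fin k) (Fin k) ℂ} (hT : IsUnit T) (i : Fin k)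
    (h : T⁻¹.mulVec (Pi.single i 1) ≠ 0) (p : PSpace k) :
    p = Projectivization.mk ℂ _ h ↔ ∀ j, j ≠ i → T.mulVec p.rep j = 0 := by
  have hdet := (Matrix.isUnit_iff_isUnit_det T).mp hT
  conv_lhs => rw [← p.mk_rep]
  rw [Projectivization.mk_eq_mk_iff']
  constructor
  · rintro ⟨a, ha⟩ j hj
    rw [← ha, Matrix.mulVec_smul, Matrix.mulVec_mulVec, Matrix.mul_nonsing_inv _ hdet,
      Matrix.one_mulVec, Pi.smul_apply, Pi.single_eq_of_ne hj, smul_zero]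
  · intro hj
    refine ⟨T.mulVec p.rep i, ?_⟩
    have h1 : T.mulVec p.rep = T.mulVec p.rep i • Pi.single i 1 := by
      ext j
      by_cases hji : j = i
      · simp [hji]
      · simp [hj j hji, hji]
    rw [← Matrix.mulVec_smul, ← h1, Matrix.mulVec_mulVec, Matrix.nonsing_inv_mul _ hdet,
      Matrix.one_mulVec]

theorem zeroSet_eq_of_span_eq {F : Fin 5 → MvPolynomial (Fin 4) ℂ}
    {T : Matrix (Fin 4) (Fin 4) ℂ} (hT : IsUnit T)
    (hs : Submodule.span ℂ (Set.range fun k => subst T (lineQuadrics k)) =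
      Submodule.span ℂ (Set.range F)) :
    ∃ (r : Projectivization.Subspace ℂ (Fin 4 → ℂ)) (p₁ p₂ : PSpace 4),
      Module.finrank ℂ r.submodule = 2 ∧ p₁ ≠ p₂ ∧
      Disjoint (Projectivization.Subspace.span {p₁, p₂} : Set (PSpace 4)) (r : Set (PSpace 4)) ∧
      zeroSet F = (r : Set (PSpace 4)) ∪ {p₁, p₂} := by
  have hdet := (Matrix.isUnit_iff_isUnit_det T).mp hT
  have hTT : ∀ x, T.mulVec (T⁻¹.mulVec x) = x := fun x => by
    rw [Matrix.mulVec_mulVec, Matrix.mul_nonsing_inv _ hdet, Matrix.one_mulVec]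
  have hTT' : ∀ x, T⁻¹.mulVec (T.mulVec x) = x := fun x => by
    rw [Matrix.mulVec_mulVec, Matrix.nonsing_inv_mul _ hdet, Matrix.one_mulVec]
  have hne : ∀ i, T⁻¹.mulVec (Pi.single i 1) ≠ 0 := by
    intro i h0
    have := hTT (Pi.single i 1)
    rw [h0, Matrix.mulVec_zero] at this
    simpa using congrFun this i
  let coords : Fin 4 → Fin 4 → (Fin 4 → ℂ) →ₗ[ℂ] ℂ × ℂ := fun i j =>
    ((LinearMap.proj i).prod (LinearMap.proj j)) ∘ₗ T.mulVecLin
  have hcoords : ∀ i j x, x ∈ LinearMap.ker (coords i j) ↔ T.mulVec x i = 0 ∧ T.mulVec x j = 0 := by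
    intro i j x
    simp [coords]
  refine ⟨(LinearMap.ker (coords 0 1)).projectivization, Projectivization.mk ℂ _ (hne 0),
    Projectivization.mk ℂ _ (hne 1), ?_, ?_, ?_, ?_⟩
  · rw [OrderIso.apply_symm_apply]
    have hsurj : LinearMap.range (coords 0 1) = ⊤ := by
      rw [LinearMap.range_eq_top]
      rintro ⟨s, t⟩
      refine ⟨T⁻¹.mulVec ![s, t, 0, 0], ?_⟩
      simp [coords, hTT]
    have := LinearMap.finrank_range_add_finrank_ker (coords 0 1)
    rw [hsurj, finrank_top] at this
    simp at this
    omega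
  · rw [ne_eq, Projectivization.mk_eq_mk_iff']
    rintro ⟨a, ha⟩
    have := congrArg T.mulVec ha
    rw [Matrix.mulVec_smul, hTT, hTT] at this
    simpa using congrFun this 0
  · rw [Set.disjoint_left]
    intro u hu hur
    -- The join of the points lies in the line where the coordinates 2 and 3 vanish, and on `r` the
    -- coordinates 0 and 1 vanish.
    have hle : Projectivization.Subspace.span
        {Projectivization.mk ℂ _ (hne 0), Projectivization.mk ℂ _ (hne 1)} ≤
        (LinearMap.ker (coords 2 3)).projectivization := by
      rw [Projectivization.Subspace.span_le_subspace_iff]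
      rintro _ (rfl | rfl)
      · rw [SetLike.mem_coe, Submodule.mk_mem_projectivization_iff, hcoords, hTT]
        simp
      · rw [SetLike.mem_coe, Submodule.mk_mem_projectivization_iff, hcoords, hTT]
        simp
    have hu' := hle hu
    induction u using Projectivization.ind with | h x hx =>
    rw [SetLike.mem_coe] at hur
    rw [Submodule.mk_mem_projectivization_iff, hcoords] at hu' hur
    apply hx
    rw [← hTT' x]
    have : T.mulVec x = 0 := by
      ext i
      fin_cases i
      exacts [hur.1, hur.2, hu'.1, hu'.2]
    rw [this, Matrix.mulVec_zero]
  · ext p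
    have hr : p ∈ (LinearMap.ker (coords 0 1)).projectivization ↔
        T.mulVec p.rep 0 = 0 ∧ T.mulVec p.rep 1 = 0 := by
      conv_lhs => rw [← p.mk_rep]
      rw [Submodule.mk_mem_projectivization_iff, hcoords]
    have hz : p ∈ zeroSet F ↔ ∀ k, eval (T.mulVec p.rep) (lineQuadrics k) = 0 := by
      have h1 : (∀ k, eval (T.mulVec p.rep) (lineQuadrics k) = 0) ↔
          Submodule.span ℂ (Set.range fun k => subst T (lineQuadrics k)) ≤
            LinearMap.ker (aeval (R := ℂ) p.rep).toLinearMap := by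
        rw [Submodule.span_le, Set.range_subset_iff]
        simp [aeval_eq_eval, eval_subst]
      rw [h1, hs, Submodule.span_le, Set.range_subset_iff]
      simp [aeval_eq_eval, zeroSet, VanishesAt]
    rw [hz, lineQuadrics_eval_eq_zero_iff, Set.mem_union, SetLike.mem_coe, hr,
      Set.mem_insert_iff, Set.mem_singleton_iff, eq_mk_inv_single_iff hT, eq_mk_inv_single_iff hT]
    simp [Fin.forall_fin_succ]

/-! ### Case distinction by the rank of the quadric. -/

theorem linearIndependent_linearCombination {n m k : ℕ} {F : Fin n → MvPolynomial (Fin m) ℂ}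
    (hF : LinearIndependent ℂ F) {l : Fin k → Fin n → ℂ} (hl : LinearIndependent ℂ l) :
    LinearIndependent ℂ fun a => Fintype.linearCombination ℂ F (l a) :=
  hl.map' (Fintype.linearCombination ℂ F)
    (LinearMap.ker_eq_bot.mpr
      (linearIndependent_iff_injective_fintypeLinearCombination.mp hF))

/-- Ranks below three are excluded by irreducibility. In ranks three and four, pairing squares as
`u² + v² = (u + iv)(u - iv)` brings the relation into product form. -/
theorem isConicType_or_isLineType {F : Fin (3 + 2) → MvPolynomial (Fin (3 + 1)) ℂ}
    {q : MvPolynomial (Fin (3 + 2)) ℂ} (hF : IsQuadraticBirationalOntoQuadric F q)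
    (hne : (zeroSet F).Nonempty) (hred : ZeroSchemeIsReduced F) :
    IsConicType (Submodule.span ℂ (Set.range F)) ∨
      (quadricRank q = 4 ∧ IsLineType (Submodule.span ℂ (Set.range F))) := by
  have hV := hF.goodSystem hne hred
  obtain ⟨k, l, hl, hq⟩ := exists_sum_squares hF.quadric
  have hk : k ≤ 5 := by simpa using hl.fintype_card_le_finrank
  have hrank : quadricRank q = k := by rw [hq, quadricRank_sum_squares hl]
  set F' : Fin k → MvPolynomial (Fin 4) ℂ := fun a => Fintype.linearCombination ℂ F (l a) with hF'
  have hli : LinearIndependent ℂ F' := linearIndependent_linearCombination hF.linearIndependent hl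
  have hmem : ∀ a, F' a ∈ Submodule.span ℂ (Set.range F) := fun a => by
    simp only [hF', Fintype.linearCombination_apply]
    exact Submodule.sum_mem _ fun j _ =>
      Submodule.smul_mem _ _ (Submodule.subset_span (Set.mem_range_self j))
  have hsum : ∑ a, F' a ^ 2 = 0 := by
    apply MvPolynomial.funext
    intro x
    have h1 := hF.eval_quadric x
    rw [hq] at h1
    rw [map_zero, ← h1]
    simp [hF', eval_linForm, Fintype.linearCombination_apply, smul_eval, dotProduct, evalForms]
  have hI : (C Complex.I : MvPolynomial (Fin 4) ℂ) ^ 2 = -1 := by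
    rw [← C_pow, Complex.I_sq, C_neg, C_1]
  have hirr := hF.irreducible_quadric
  rw [hq] at hirr
  have hI' : (C Complex.I : MvPolynomial (Fin 5) ℂ) ^ 2 = -1 := by
    rw [← C_pow, Complex.I_sq, C_neg, C_1]
  interval_cases k
  · exact absurd (by simp) hirr.ne_zero
  · refine absurd hirr ?_
    rw [Fin.sum_univ_one, pow_two]
    exact not_irreducible_linForm_mul _ _
  · refine absurd hirr ?_
    have : ∑ i, linForm (l i) ^ 2 =
        linForm (l 0 + Complex.I • l 1) * linForm (l 0 - Complex.I • l 1) := by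
      rw [Fin.sum_univ_two, map_add, map_sub, map_smul, smul_eq_C_mul]
      linear_combination linForm (l 1) ^ 2 * hI'
    rw [this]
    exact not_irreducible_linForm_mul _ _
  · exfalso
    have hlf := Fintype.linearIndependent_iff.mp hli
    -- The outer entries multiply to `F'₀² + F'₁² = -F'₂²`, the square of the middle one.
    refine not_rank_three hV (f := ![F' 0 + Complex.I • F' 1, Complex.I • F' 2,
      F' 0 - Complex.I • F' 1]) ?_ ?_ ?_
    · intro i
      fin_cases i
      · exact Submodule.add_mem _ (hmem 0) (Submodule.smul_mem _ _ (hmem 1))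
      · exact Submodule.smul_mem _ _ (hmem 2)
      · exact Submodule.sub_mem _ (hmem 0) (Submodule.smul_mem _ _ (hmem 1))
    · rw [Fintype.linearIndependent_iff]
      intro g hg
      simp only [Fin.sum_univ_three, Matrix.cons_val] at hg
      have h := hlf ![g 0 + g 2, Complex.I * (g 0 - g 2), Complex.I * g 1] (by
        simp only [Fin.sum_univ_three, Matrix.cons_val]
        rw [← hg]
        module)
      have e0 := h 0
      have e1 := h 1
      have e2 := h 2
      simp only [Matrix.cons_val, mul_eq_zero, Complex.I_ne_zero, false_or] at e0 e1 e2
      intro i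
      fin_cases i
      · change g 0 = 0
        linear_combination (e0 + e1) / 2
      · exact e2
      · change g 2 = 0
        linear_combination (e0 - e1) / 2
    · simp only [Matrix.cons_val, smul_eq_C_mul]
      rw [Fin.sum_univ_three] at hsum
      linear_combination hsum - (F' 1 ^ 2 + F' 2 ^ 2) * hI
  · have hlf := Fintype.linearIndependent_iff.mp hli
    -- The relation becomes `F'₀² + F'₁² = -(F'₂² + F'₃²)` with both sides factored; the sign is put
    -- into the second entry.
    have h4 := isConicType_or_isLineType_of_rank_four hV (f := ![F' 0 + Complex.I • F' 1,
      -(F' 2 + Complex.I • F' 3), F' 2 - Complex.I • F' 3, F' 0 - Complex.I • F' 1]) ?_ ?_ ?_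
    · exact h4.imp id fun h => ⟨hrank, h⟩
    · intro i
      fin_cases i
      · exact Submodule.add_mem _ (hmem 0) (Submodule.smul_mem _ _ (hmem 1))
      · exact Submodule.neg_mem _ (Submodule.add_mem _ (hmem 2) (Submodule.smul_mem _ _ (hmem 3)))
      · exact Submodule.sub_mem _ (hmem 2) (Submodule.smul_mem _ _ (hmem 3))
      · exact Submodule.sub_mem _ (hmem 0) (Submodule.smul_mem _ _ (hmem 1))
    · rw [Fintype.linearIndependent_iff]
      intro g hg
      simp only [Fin.sum_univ_four, Matrix.cons_val] at hg
      have h := hlf ![g 0 + g 3, Complex.I * (g 0 - g 3), g 2 - g 1, -Complex.I * (g 1 + g 2)] (by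
        simp only [Fin.sum_univ_four, Matrix.cons_val]
        rw [← hg]
        module)
      have e0 := h 0
      have e1 := h 1
      have e2 := h 2
      have e3 := h 3
      simp only [Matrix.cons_val, mul_eq_zero, neg_eq_zero, Complex.I_ne_zero, false_or] at e0 e1 e2 e3
      intro i
      fin_cases i
      · change g 0 = 0
        linear_combination (e0 + e1) / 2
      · change g 1 = 0
        linear_combination (e3 - e2) / 2
      · change g 2 = 0
        linear_combination (e3 + e2) / 2
      · change g 3 = 0
        linear_combination (e0 - e1) / 2
    · simp only [Matrix.cons_val, smul_eq_C_mul]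
      rw [Fin.sum_univ_four] at hsum
      linear_combination hsum - (F' 1 ^ 2 + F' 3 ^ 2) * hI
  · refine Or.inl (isConicType_of_rank_five hV hmem hli fun x => ?_)
    have := congrArg (eval x) hsum
    simpa using this

end QuadBir

theorem proposition7p2
    (F : Fin (3 + 2) → MvPolynomial (Fin (3 + 1)) ℂ) (q : MvPolynomial (Fin (3 + 2)) ℂ)
    (hF : QuadBir.IsQuadraticBirationalOntoQuadric F q)
    (hne : (QuadBir.zeroSet F).Nonempty)
    (hred : QuadBir.ZeroSchemeIsReduced F) :
    QuadBir.IsOfTypeTwo F q 1 ∨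
      (QuadBir.IsOfTypeTwo F q 2 ∧ QuadBir.quadricRank q = 4 ∧
        ∃ (r : Projectivization.Subspace ℂ (Fin (3 + 1) → ℂ)) (p₁ p₂ : QuadBir.PSpace (3 + 1)),
          Module.finrank ℂ r.submodule = 2 ∧ p₁ ≠ p₂ ∧
          Disjoint (Projectivization.Subspace.span {p₁, p₂} : Set (QuadBir.PSpace (3 + 1)))
            (r : Set (QuadBir.PSpace (3 + 1))) ∧
          QuadBir.zeroSet F = (r : Set (QuadBir.PSpace (3 + 1))) ∪ {p₁, p₂}) := by
  rcases QuadBir.isConicType_or_isLineType hF hne hred with h | ⟨hrank, h⟩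
  · exact Or.inl (QuadBir.isOfTypeTwo_one hF h)
  · right
    obtain ⟨T, hT, hs⟩ := h.exists_span_eq (hF.goodSystem hne hred)
    refine ⟨⟨hF, QuadBir.isInverse_two_of_span_eq hF hT hs, ?_⟩, hrank,
      QuadBir.zeroSet_eq_of_span_eq hT hs⟩
    rintro e ⟨G, hG⟩
    by_contra! he
    interval_cases e
    · exact QuadBir.not_isInverseOfDegree_zero hF G hG
    · exact QuadBir.not_isInverse_one_of_span_eq hF hT hs G hG
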